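/- Let $T,W>0$, $\mathbf T=[-T,T]^2$ and $\mathbf W=[-W,W]^2$ in $\mathbb R^2$, and let $\mathbb H$ be the real quaternions with units $\mathbf i,\mathbf j,\mathbf k$. For $f\in L^2(\mathbb R^2;\mathbb H)$ let $$\mathcal F(f)(u,v)=\frac1{2\pi}\int_{\mathbb R^2}e^{-\mathbf iux}f(x,y)e^{-\mathbf jvy}\,dx\,dy$$ be the two-sided quaternionic Fourier transform, understood as the $L^2$-limit, as $n\to\infty$, of the transforms of $f\chi_{[-n,n]^2}$ (this limit exists for every $f\in L^2(\mathbb R^2;\mathbb H)$). For $f=f_0+\mathbf if_1+\mathbf jf_2+\mathbf kf_3$ with real-valued $f_i$ put $|\mathcal F(f)|_Q^2=\sum_{i=0}^3|\mathcal F(f_i)|^2$. Let $D_{\mathbf T}f=f\chi_{\mathbf T}$, and for $g\in L^2(\mathbb R^2;\mathbb H)$, $g\ne0$, define $\xi(g),\eta_Q(g)\ge0$ by $$\xi(g)^2=\frac{\int_{\mathbf T}|g|^2}{\int_{\mathbb R^2}|g|^2},\qquad \eta_Q(g)^2=\frac{\int_{\mathbf W}|\mathcal F(g)|_Q^2}{\int_{\mathbb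 R^2}|\mathcal F(g)|_Q^2}.$$ Among the real eigenvalues $\lambda$ (with non-zero eigenfunctions $\psi\in L^2(\mathbb R^2;\mathbb H)$) of the integral equation $$\lambda\,\psi(x,y)=\int_{\mathbf T}\psi(s,t)\,\frac{\sin W(x-s)}{\pi(x-s)}\,\frac{\sin W(y-t)}{\pi(y-t)}\,ds\,dt$$ there is a largest one, $\lambda_0$. Let $\sqrt{\lambda_0}\le\xi<1$. Then: (a) every $g\in L^2(\mathbb R^2;\mathbb H)$ with $\|g\|_{L^2}=1$ and $\xi(g)=\xi$ satisfies $$\arccos\xi+\arccos\eta_Q(g)\ge\arccos\sqrt{\lambda_0};$$ (b) for every eigenfunction $\psi_0$ for $\lambda_0$ with $\|\psi_0\|_{L^2}=1$, the signal $g^*=p\,\psi_0+q\,D_{\mathbf T}\psi_0$ with $$p=\sqrt{\frac{1-\xi^2}{1-\lambda_0}},\qquad q=\frac{\xi}{\sqrt{\lambda_0}}-\sqrt{\frac{1-\xi^2}{1-\lambda_0}}$$ satisfies $\|g^*\|_{L^2}=1$, $\xi(g^*)=\xi$ and $\arccos\xi+\arccos\eta_Q(g^*)=\arccos\sqrt{\lambda_0}$;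 (c) consequently the maximum $\eta\in[0,1]$ of $\eta_Q(g)$ over all $g$ with $\|g\|_{L^2}=1$ and $\xi(g)=\xi$ exists, and $\arccos\xi+\arccos\eta=\arccos\sqrt{\lambda_0}$. -/

import Mathlib

open MeasureTheory Set Filter Topology
open scoped Quaternion

namespace QPSWF

/-- The quaternion exponential `e^{iθ} = cos θ + i sin θ`. -/
noncomputable def expI (θ : ℝ) : ℍ[ℝ] := ⟨Real.cos θ, Real.sin θ, 0, 0⟩

/-- The quaternion exponential `e^{jθ} = cos θ + j sin θ`. -/
noncomputable def expJ (θ : ℝ) : ℍ[ℝ] := ⟨Real.cos θ, 0, Real.sin θ, 0⟩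

/-- The square `[-a, a] × [-a, a]` in the plane. -/
def square (a : ℝ) : Set (ℝ × ℝ) := Icc (-a) a ×ˢ Icc (-a) a

/-- The two-sided quaternionic Fourier transform of an integrable signal,
`(2π)⁻¹ ∫ e^{-iux} f(x,y) e^{-jvy} dx dy`. -/
noncomputable def qftL1 (f : ℝ × ℝ → ℍ[ℝ]) (w : ℝ × ℝ) : ℍ[ℝ] :=
  (2 * Real.pi)⁻¹ • ∫ z : ℝ × ℝ, expI (-(w.1 * z.1)) * f z * expJ (-(w.2 * z.2))

/-- `F` is the quaternionic Fourier transform of the square-integrable signal `f`: it is the limit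
in `L²` of the (absolutely convergent) transforms of the truncations of `f` to `[-n, n]²`. -/
def IsQFT (f F : ℝ × ℝ → ℍ[ℝ]) : Prop :=
  MemLp F 2 volume ∧
    Tendsto (fun n : ℕ => eLpNorm (fun w => qftL1 ((square (n : ℝ)).indicator f) w - F w) 2 volume)
      atTop (𝓝 0)

open Classical in
/-- The quaternionic Fourier transform on `L²` (determined up to a null set). -/
noncomputable def qft (f : ℝ × ℝ → ℍ[ℝ]) : ℝ × ℝ → ℍ[ℝ] :=
  if h : ∃ F, IsQFT f F then h.choose else 0

/-- The squared `Q`-modulus `|F(f)|_Q² = ∑ᵢ |F(fᵢ)|²` of the transform of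
`f = f₀ + i f₁ + j f₂ + k f₃`, where the `fᵢ` are the real components of `f`. -/
noncomputable def qModSq (f : ℝ × ℝ → ℍ[ℝ]) (w : ℝ × ℝ) : ℝ :=
  ‖qft (fun z => (((f z).re : ℝ) : ℍ[ℝ])) w‖ ^ 2 +
  ‖qft (fun z => (((f z).imI : ℝ) : ℍ[ℝ])) w‖ ^ 2 +
  ‖qft (fun z => (((f z).imJ : ℝ) : ℍ[ℝ])) w‖ ^ 2 +
  ‖qft (fun z => (((f z).imK : ℝ) : ℍ[ℝ])) w‖ ^ 2

/-- The total energy of a signal. -/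
noncomputable def energy (g : ℝ × ℝ → ℍ[ℝ]) : ℝ := ∫ z, ‖g z‖ ^ 2

/-- The time-limiting operator: multiplication by the indicator function of `[-T, T]²`. -/
noncomputable def timeLimit (T : ℝ) (g : ℝ × ℝ → ℍ[ℝ]) : ℝ × ℝ → ℍ[ℝ] := (square T).indicator g

/-- The energy ratio `ξ` of a signal in the time domain `[-T, T]²`. -/
noncomputable def timeRatio (T : ℝ) (g : ℝ × ℝ → ℍ[ℝ]) : ℝ :=
  √(energy (timeLimit T g) / energy g)

/-- The energy ratio `η_Q` of a signal in the frequency domain `[-W, W]²`, with the energy of the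
transform measured by the `Q`-modulus. -/
noncomputable def freqRatio (W : ℝ) (g : ℝ × ℝ → ℍ[ℝ]) : ℝ :=
  √((∫ w in square W, qModSq g w) / ∫ w, qModSq g w)

/-- The signals of unit energy whose energy ratio in `[-T, T]²` is `ξ`. -/
def unitSignals (T ξ : ℝ) : Set (ℝ × ℝ → ℍ[ℝ]) :=
  {g | MemLp g 2 volume ∧ energy g = 1 ∧ timeRatio T g = ξ}

/-- The function `sin (W r) / (π r)`, with its continuous value `W / π` at `r = 0`. -/
noncomputable def sincKernel (W r : ℝ) : ℝ :=
  if r = 0 then W / Real.pi else Real.sin (W * r) / (Real.pi * r)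

/-- `ψ ≠ 0` is a square-integrable solution of the integral equation
`lam ψ(x,y) = ∫_{[-T,T]²} ψ(s,t) (sin W(x-s) / π(x-s)) (sin W(y-t) / π(y-t)) ds dt`. -/
def IsSincEigenfunction (T W lam : ℝ) (ψ : ℝ × ℝ → ℍ[ℝ]) : Prop :=
  MemLp ψ 2 volume ∧ ¬ (ψ =ᵐ[volume] 0) ∧
    ∀ᵐ z : ℝ × ℝ, lam • ψ z =
      ∫ s in square T, (sincKernel W (z.1 - s.1) * sincKernel W (z.2 - s.2)) • ψ s

/-- The eigenvalues of the sinc-kernel integral equation. -/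
def sincEigenvalues (T W : ℝ) : Set ℝ := {lam | ∃ ψ, IsSincEigenfunction T W lam ψ}

end QPSWF

open QPSWF

/-! The theorem is angle geometry for two orthogonal projections. Recording the four real components
of a signal as a vector in `C4` places signals in the complex Hilbert space L²(ℝ²; ℂ⁴). There P is
restriction to the time square and Q is restriction of the ordinary Fourier transform to the
frequency square.

The quaternionic transform reduces to the complex one F. Since ½(1 - sk)e^{-jb} = e^{-isb}·½(1 - sk)
for s = ±1, each two-sided exponential splits into two complex exponentials with phases a + b and a
- b (`expI_mul_mul_expJ`). Hence |𝓕(g)|_Q² is the mean of ‖F‖² at (u,v) and at (u,-v)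
(`qModSq_ae_eq`). The frequency square is invariant under this reflection, so ξ(g) = ‖Pg‖ and η_Q(g)
= ‖Qg‖ for unit g (`timeRatio_eq`, `freqRatio_eq`).

For unit g the angle between g and Pg is arccos ‖Pg‖, likewise for Q, and the angle between Pg and
Qg is at least arccos ‖QP‖. The triangle inequality for angles gives (a) with ‖QP‖ in place of √λ₀
(`arccos_norm_comp_le`). Equality holds for a suitable vector in the plane of ψ₀ and Pψ₀
(`extremal_of_eigen`), which gives (b); (c) follows by monotonicity of arccos.

It remains to see that λ₀ = ‖QP‖². The operator QP is the sinc-kernel operator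
(`bandProj_timeProj_ae_eq`). Its norm is attained by weak compactness
(`exists_norm_bandProj_timeProj_eq`), a norm-attaining vector yields an eigenvector for ‖QP‖², and
no real eigenvalue is larger (`isGreatest_sincEigenvalues`). -/

namespace QPSWF

/-! ### Angles and eigenvectors for a pair of orthogonal projections -/

section Hilbert

variable {H : Type*} [NormedAddCommGroup H] [InnerProductSpace ℂ H]

/-- Orthogonal projections, as symmetric idempotent continuous linear maps. -/
structure IsOrthProj (P : H →L[ℂ] H) : Prop where
  symm : ∀ x y, inner ℂ (P x) y = inner ℂ x (P y)
  idem : ∀ x, P (P x) = P x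

theorem IsOrthProj.inner_apply_left {P : H →L[ℂ] H} (hP : IsOrthProj P) (x : H) :
    inner ℂ (P x) x = ((‖P x‖ ^ 2 : ℝ) : ℂ) := by
  rw [← hP.idem x, hP.symm, hP.idem x, inner_self_eq_norm_sq_to_K]
  simp

/-- Cauchy–Schwarz after writing ⟨Px, Qy⟩ = ⟨QP(Px), Qy⟩: the cosine of the angle between the two
ranges is at most ‖QP‖. -/
theorem re_inner_proj_le {P Q : H →L[ℂ] H} (hP : IsOrthProj P) (hQ : IsOrthProj Q) (x y : H) :
    (inner ℂ (P x) (Q y)).re ≤ ‖Q ∘L P‖ * ‖P x‖ * ‖Q y‖ := by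
  have h : inner ℂ (P x) (Q y) = inner ℂ ((Q ∘L P) (P x)) (Q y) := by
    rw [ContinuousLinearMap.comp_apply, hP.idem, hQ.symm, hQ.idem]
  rw [h]
  refine (Complex.re_le_norm _).trans ((norm_inner_le_norm _ _).trans ?_)
  gcongr
  exact (Q ∘L P).le_opNorm _

theorem arccos_norm_comp_le {P Q : H →L[ℂ] H} (hP : IsOrthProj P) (hQ : IsOrthProj Q) {g : H}
    (hg : ‖g‖ = 1) :
    Real.arccos ‖Q ∘L P‖ ≤ Real.arccos ‖P g‖ + Real.arccos ‖Q g‖ := by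
  let _ := InnerProductSpace.rclikeToReal ℂ H
  have hin : ∀ x y : H, inner ℝ x y = (inner ℂ x y).re := fun x y => rfl
  -- This survives `A g = 0`: the angle with the zero vector is π/2 by convention, which is arccos
  -- 0.
  have key : ∀ {A : H →L[ℂ] H}, IsOrthProj A → InnerProductGeometry.angle (A g) g =
      Real.arccos ‖A g‖ := by
    intro A hA
    rw [InnerProductGeometry.angle, hin, hA.inner_apply_left, hg, Complex.ofReal_re]
    rcases eq_or_ne ‖A g‖ 0 with h | h
    · simp [h]
    · congr 1
      field_simp
  have h1 := InnerProductGeometry.angle_le_angle_add_angle (P g) g (Q g)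
  rw [InnerProductGeometry.angle_comm g, key hP, key hQ] at h1
  refine le_trans ?_ h1
  rw [InnerProductGeometry.angle, hin]
  refine Real.arccos_le_arccos ?_
  refine div_le_of_le_mul₀ (by positivity) (norm_nonneg _) ?_
  rw [← mul_assoc]
  exact re_inner_proj_le hP hQ g g

theorem IsOrthProj.apply_eq_of_eigen {P Q : H →L[ℂ] H} (hQ : IsOrthProj Q) {lam : ℝ}
    (hlam : lam ≠ 0) {ψ : H} (h : Q (P ψ) = (lam : ℂ) • ψ) : Q ψ = ψ := by
  have hl : (lam : ℂ) ≠ 0 := by exact_mod_cast hlam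
  have := congrArg Q h
  rw [hQ.idem, h, map_smul] at this
  exact (smul_right_injective H hl this).symm

/-- An eigenvector with nonzero eigenvalue lies in the range of Q, so ⟨Pψ, ψ⟩ = ⟨Pψ, Qψ⟩ = ⟨QPψ, ψ⟩.
-/
theorem norm_sq_apply_of_eigen {P Q : H →L[ℂ] H} (hP : IsOrthProj P) (hQ : IsOrthProj Q)
    {lam : ℝ} (hlam : lam ≠ 0) {ψ : H} (h : Q (P ψ) = (lam : ℂ) • ψ) :
    ‖P ψ‖ ^ 2 = lam * ‖ψ‖ ^ 2 := by
  have h1 := hP.inner_apply_left ψ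
  have h2 := hQ.apply_eq_of_eigen hlam h
  rw [← h2, ← hQ.symm, h2, h, inner_smul_left, inner_self_eq_norm_sq_to_K] at h1
  have := congrArg Complex.re h1
  simp only [Complex.conj_ofReal, Complex.coe_algebraMap] at this
  norm_cast at this
  exact this.symm

theorem eigenvalue_le_norm_sq {P Q : H →L[ℂ] H} (hP : IsOrthProj P) (hQ : IsOrthProj Q)
    {lam : ℝ} {ψ : H} (hψ : ψ ≠ 0) (h : Q (P ψ) = (lam : ℂ) • ψ) : lam ≤ ‖Q ∘L P‖ ^ 2 := by
  rcases le_or_gt lam 0 with hl | hl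
  · exact hl.trans (by positivity)
  have h1 := norm_sq_apply_of_eigen hP hQ hl.ne' h
  have h2 : lam * ‖ψ‖ ≤ ‖Q ∘L P‖ * ‖P ψ‖ := by
    have := (Q ∘L P).le_opNorm (P ψ)
    rw [ContinuousLinearMap.comp_apply, hP.idem, h, norm_smul] at this
    simpa [abs_of_pos hl] using this
  have h3 : (lam * ‖ψ‖) ^ 2 ≤ (‖Q ∘L P‖ * ‖P ψ‖) ^ 2 := by gcongr
  have hpos : 0 < ‖ψ‖ := norm_pos_iff.2 hψ
  rw [mul_pow, mul_pow, h1] at h3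
  have h4 : 0 < lam * ‖ψ‖ ^ 2 := by positivity
  nlinarith

/-- With c = ‖QP‖, expanding ‖PQPf - c²f‖² gives at most c⁴ - 2c⁴ + c⁴ = 0. Thus f is an eigenvector
of PQP, and QPf is one of QP. -/
theorem exists_eigenvector_of_norm_attained {P Q : H →L[ℂ] H} (hP : IsOrthProj P)
    (hQ : IsOrthProj Q) (h0 : Q ∘L P ≠ 0) {f : H} (hf : ‖f‖ ≤ 1)
    (hmax : ‖(Q ∘L P) f‖ = ‖Q ∘L P‖) :
    ∃ ψ : H, ψ ≠ 0 ∧ Q (P ψ) = ((‖Q ∘L P‖ ^ 2 : ℝ) : ℂ) • ψ := by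
  set c := ‖Q ∘L P‖ with hc
  rw [ContinuousLinearMap.comp_apply] at hmax
  have hQP : ‖P (Q (P f))‖ ≤ c * c := by
    have h1 := re_inner_proj_le hP hQ (Q (P f)) (P f)
    rw [← hc, hP.symm, hQ.symm, ← hQ.symm, ← hP.symm, ← hP.idem (Q (P f)), hP.symm, hP.idem] at h1
    rcases eq_or_ne ‖P (Q (P f))‖ 0 with h | h
    · rw [h]; exact mul_self_nonneg c
    have h2 : (inner ℂ (P (Q (P f))) (P (Q (P f)))).re = ‖P (Q (P f))‖ ^ 2 := by
      rw [inner_self_eq_norm_sq_to_K]; norm_cast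
    rw [h2, hmax, pow_two] at h1
    have hp : 0 < ‖P (Q (P f))‖ := lt_of_le_of_ne (norm_nonneg _) h.symm
    nlinarith
  have hin : inner ℂ (P (Q (P f))) f = ((c ^ 2 : ℝ) : ℂ) := by
    rw [hP.symm, hQ.inner_apply_left, hmax]
  have hz : P (Q (P f)) - ((c ^ 2 : ℝ) : ℂ) • f = 0 := by
    rw [← norm_eq_zero, ← sq_eq_zero_iff]
    refine le_antisymm ?_ (by positivity)
    rw [@norm_sub_sq ℂ, inner_smul_right, hin, norm_smul]
    have e1 : RCLike.re (((c ^ 2 : ℝ) : ℂ) * ((c ^ 2 : ℝ) : ℂ)) = c ^ 4 := by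
      rw [← Complex.ofReal_mul]
      change ((c ^ 2 * c ^ 2 : ℝ) : ℂ).re = c ^ 4
      rw [Complex.ofReal_re]; ring
    rw [e1, Complex.norm_real, Real.norm_of_nonneg (sq_nonneg c)]
    have e2 : ‖P (Q (P f))‖ ^ 2 ≤ (c * c) ^ 2 := by gcongr
    have e3 : (c ^ 2 * ‖f‖) ^ 2 ≤ (c ^ 2 * 1) ^ 2 := by gcongr
    nlinarith
  refine ⟨Q (P f), ?_, ?_⟩
  · rw [← norm_pos_iff, hmax]; exact norm_pos_iff.2 h0
  · rw [sub_eq_zero] at hz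
    -- Applying P replaces c²f by c²Pf, so that a further Q returns c²·QPf.
    have := congrArg P hz
    rw [hP.idem, map_smul] at this
    rw [this, map_smul]

/-- The extremal element `p ψ + q P ψ` for the angle inequality. -/
theorem extremal_of_eigen {P Q : H →L[ℂ] H} (hP : IsOrthProj P) (hQ : IsOrthProj Q)
    {lam : ℝ} (hlam : 0 < lam) {ψ : H} (hψ : ‖ψ‖ = 1) (h : Q (P ψ) = (lam : ℂ) • ψ) {ξ : ℝ}
    (hξ : √lam ≤ ξ) (hξ1 : ξ < 1) {p q : ℝ} (hp : p = √((1 - ξ ^ 2) / (1 - lam)))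
    (hq : q = ξ / √lam - √((1 - ξ ^ 2) / (1 - lam))) :
    ‖(p : ℂ) • ψ + (q : ℂ) • P ψ‖ = 1 ∧ ‖P ((p : ℂ) • ψ + (q : ℂ) • P ψ)‖ = ξ ∧
      Real.arccos ξ + Real.arccos ‖Q ((p : ℂ) • ψ + (q : ℂ) • P ψ)‖ = Real.arccos √lam := by
  have hs : 0 < √lam := Real.sqrt_pos.2 hlam
  have hss : √lam ^ 2 = lam := Real.sq_sqrt hlam.le
  have hξ0 : 0 < ξ := hs.trans_le hξ
  have hlam1 : lam < 1 := by
    rw [← hss]; nlinarith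
  have hPψ := norm_sq_apply_of_eigen hP hQ hlam.ne' h
  rw [hψ, one_pow, mul_one] at hPψ
  have hpq : p + q = ξ / √lam := by rw [hp, hq]; ring
  have hp0 : 0 ≤ p := hp ▸ Real.sqrt_nonneg _
  have hp2 : p ^ 2 * (1 - lam) = 1 - ξ ^ 2 := by
    rw [hp, Real.sq_sqrt (div_nonneg (by nlinarith) (by linarith))]
    field_simp [(by linarith : (1 : ℝ) - lam ≠ 0)]
  have hPg : P ((p : ℂ) • ψ + (q : ℂ) • P ψ) = ((ξ / √lam : ℝ) : ℂ) • P ψ := by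
    rw [map_add, map_smul, map_smul, hP.idem, ← add_smul, ← hpq]; push_cast; rfl
  have hQg : Q ((p : ℂ) • ψ + (q : ℂ) • P ψ) = ((p + q * lam : ℝ) : ℂ) • ψ := by
    rw [map_add, map_smul, map_smul, h, hQ.apply_eq_of_eigen hlam.ne' h, smul_smul, ← add_smul]
    push_cast; rfl
  have hnPψ : ‖P ψ‖ = √lam := by rw [← hPψ, Real.sqrt_sq (norm_nonneg _)]
  -- The right-hand side is cos(arccos √λ - arccos ξ); p and q are chosen so that ‖Qg‖ takes this
  -- value.
  have hη : p + q * lam = √(1 - ξ ^ 2) * √(1 - lam) + ξ * √lam := by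
    have e1 : p * (1 - lam) = √(1 - ξ ^ 2) * √(1 - lam) := by
      rw [← hp2, Real.sqrt_mul (sq_nonneg p), Real.sqrt_sq hp0, mul_assoc,
        Real.mul_self_sqrt (by linarith)]
    have e2 : (p + q) * lam = ξ * √lam := by
      rw [hpq]; nth_rw 2 [← hss]; field_simp
    linarith
  refine ⟨?_, ?_, ?_⟩
  · have h1 : ‖(p : ℂ) • ψ + (q : ℂ) • P ψ‖ ^ 2 = 1 := by
      rw [@norm_add_sq ℂ, inner_smul_left, inner_smul_right, norm_smul, norm_smul, hψ, hnPψ,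
        ← hP.symm, hP.inner_apply_left, hPψ]
      have e : RCLike.re ((starRingEnd ℂ) (p : ℂ) * ((q : ℂ) * (lam : ℂ))) = p * (q * lam) := by
        rw [Complex.conj_ofReal]; norm_cast
      rw [e, Complex.norm_real, Complex.norm_real, mul_pow, mul_pow, hss]
      simp only [Real.norm_eq_abs, sq_abs]
      -- The squared norm regroups as p²(1 - λ) + (p + q)²λ = (1 - ξ²) + ξ².
      have : (p + q) ^ 2 * lam = ξ ^ 2 := by
        rw [hpq, div_pow, hss]; field_simp
      nlinarith
    exact (pow_eq_one_iff_of_nonneg (norm_nonneg _) two_ne_zero).1 h1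
  · rw [hPg, norm_smul, hnPψ, Complex.norm_real, Real.norm_of_nonneg (by positivity)]
    field_simp
  · rw [hQg, norm_smul, hψ, mul_one, Complex.norm_real, hη, Real.norm_of_nonneg (by positivity)]
    have e : √(1 - ξ ^ 2) * √(1 - lam) + ξ * √lam =
        Real.cos (Real.arccos √lam - Real.arccos ξ) := by
      rw [Real.cos_sub, Real.cos_arccos (by linarith) (by linarith),
        Real.cos_arccos (by linarith) (by linarith), Real.sin_arccos, Real.sin_arccos, hss]
      ring
    rw [e, Real.arccos_cos]
    · ring
    · linarith [Real.arccos_le_arccos hξ]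
    · linarith [Real.arccos_le_pi √lam, Real.arccos_nonneg ξ]

end Hilbert

/-! ### Agreement of the L² Fourier transform with the Fourier integral -/

section Fourier
open scoped FourierTransform SchwartzMap
variable {V E : Type*} [NormedAddCommGroup V] [InnerProductSpace ℝ V] [FiniteDimensional ℝ V]
  [MeasurableSpace V] [BorelSpace V] [NormedAddCommGroup E] [InnerProductSpace ℂ E]

theorem continuous_fourier_of_integrable {f : V → E} (h1 : Integrable f) : Continuous (𝓕 f) :=
  VectorFourier.fourierIntegral_continuous Real.continuous_fourierChar
    continuous_inner h1

theorem continuous_fourierInv_of_integrable {f : V → E} (h1 : Integrable f) :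
    Continuous (𝓕⁻ f) := by
  have : 𝓕⁻ f = fun w => 𝓕 f (-w) := by
    ext w; rw [Real.fourierInv_eq_fourier_neg]
  rw [this]
  exact (continuous_fourier_of_integrable h1).comp continuous_neg

variable [CompleteSpace E]

theorem integral_fourier_smul {φ : V → ℂ} {f : V → E} (hφ : Integrable φ) (h1 : Integrable f) :
    ∫ v, 𝓕 φ v • f v = ∫ v, φ v • 𝓕 f v := by
  have := VectorFourier.integral_fourierIntegral_smul_eq_flip (L := innerₗ V) (f := φ) (g := f)
    (μ := volume) (ν := volume) Real.continuous_fourierChar continuous_inner hφ h1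
  rw [flip_innerₗ] at this
  exact this

theorem integral_fourierInv_smul {φ : V → ℂ} {f : V → E} (hφ : Integrable φ) (h1 : Integrable f) :
    ∫ v, 𝓕⁻ φ v • f v = ∫ v, φ v • 𝓕⁻ f v := by
  rw [← integral_neg_eq_self, Real.fourierInv_eq_fourier_comp_neg f]
  simp_rw [Real.fourierInv_eq_fourier_neg φ, neg_neg]
  exact integral_fourier_smul hφ h1.comp_neg

/-- Smooth compactly supported real functions, viewed as complex Schwartz functions, already
separate locally integrable functions. -/
theorem ae_eq_of_integral_schwartz_smul_eq {f g : V → E} (hf : LocallyIntegrable f)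
    (hg : LocallyIntegrable g) (h : ∀ φ : 𝓢(V, ℂ), ∫ v, φ v • f v = ∫ v, φ v • g v) :
    f =ᵐ[volume] g := by
  refine ae_eq_of_integral_contDiff_smul_eq hf hg fun φ hφ hφc => ?_
  have hc : HasCompactSupport (fun v => (φ v : ℂ)) := hφc.comp_left (g := Complex.ofReal) rfl
  have hd : ContDiff ℝ (⊤ : ℕ∞) (fun v => (φ v : ℂ)) := Complex.ofRealCLM.contDiff.comp hφ
  exact h (hc.toSchwartzMap hd)

/-- The `L²` Fourier transform of an integrable function is given by the Fourier integral. -/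
theorem fourier_toLp_two_ae_eq {f : V → E} (h1 : Integrable f) (h2 : MemLp f 2) :
    (𝓕 (h2.toLp f) : Lp E 2 (volume : Measure V)) =ᵐ[volume] 𝓕 f := by
  -- Against a Schwartz function, the L² transform moves onto the test function as a tempered
  -- distribution, and the integral transform does so by Fubini (`integral_fourier_smul`).
  refine ae_eq_of_integral_schwartz_smul_eq ((Lp.memLp _).locallyIntegrable (by norm_num))
    (continuous_fourier_of_integrable h1).locallyIntegrable fun φ => ?_
  rw [← Lp.toTemperedDistribution_apply, ← Lp.fourier_toTemperedDistribution_eq,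
    TemperedDistribution.fourier_apply, Lp.toTemperedDistribution_apply]
  rw [← integral_fourier_smul φ.integrable h1]
  refine integral_congr_ae ?_
  filter_upwards [h2.coeFn_toLp] with v hv
  rw [hv, SchwartzMap.fourier_coe]

theorem fourierInv_toLp_two_ae_eq {f : V → E} (h1 : Integrable f) (h2 : MemLp f 2) :
    (𝓕⁻ (h2.toLp f) : Lp E 2 (volume : Measure V)) =ᵐ[volume] 𝓕⁻ f := by
  refine ae_eq_of_integral_schwartz_smul_eq ((Lp.memLp _).locallyIntegrable (by norm_num))
    (continuous_fourierInv_of_integrable h1).locallyIntegrable fun φ => ?_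
  rw [← Lp.toTemperedDistribution_apply, ← Lp.fourierInv_toTemperedDistribution_eq,
    TemperedDistribution.fourierInv_apply, Lp.toTemperedDistribution_apply]
  rw [← integral_fourierInv_smul φ.integrable h1]
  refine integral_congr_ae ?_
  filter_upwards [h2.coeFn_toLp] with v hv
  rw [hv, SchwartzMap.fourierInv_coe]

end Fourier
-- Truncation as a projection on L²
section Indicator
variable {α E : Type*} [MeasurableSpace α] {μ : Measure α} [NormedAddCommGroup E] [InnerProductSpace ℂ E]

/-- Multiplication by the indicator function of a measurable set, on `L²`. -/
noncomputable def indicatorL2 (μ : Measure α) (E : Type*) [NormedAddCommGroup E]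
    [InnerProductSpace ℂ E] {s : Set α} (hs : MeasurableSet s) : Lp E 2 μ →L[ℂ] Lp E 2 μ :=
  LinearMap.mkContinuous
    { toFun := fun f => ((Lp.memLp f).indicator hs).toLp (s.indicator f)
      map_add' := fun f g => by
        rw [← MemLp.toLp_add, MemLp.toLp_eq_toLp_iff]
        filter_upwards [Lp.coeFn_add f g] with x hx
        by_cases h : x ∈ s
        · simpa [h] using hx
        · simp [h]
      map_smul' := fun c f => by
        rw [RingHom.id_apply, ← MemLp.toLp_const_smul, MemLp.toLp_eq_toLp_iff]
        filter_upwards [Lp.coeFn_smul c f] with x hx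
        by_cases h : x ∈ s <;> simp [h, hx] } 1 (fun f => by
      rw [one_mul]
      change ‖((Lp.memLp f).indicator hs).toLp (s.indicator f)‖ ≤ ‖f‖
      refine (Lp.norm_toLp _ _).trans_le ?_
      rw [Lp.norm_def]
      exact ENNReal.toReal_mono (Lp.eLpNorm_ne_top f) (eLpNorm_indicator_le _))

theorem indicatorL2_apply {s : Set α} (hs : MeasurableSet s) (f : Lp E 2 μ) :
    indicatorL2 μ E hs f = ((Lp.memLp f).indicator hs).toLp (s.indicator f) := rfl

theorem coeFn_indicatorL2 {s : Set α} (hs : MeasurableSet s) (f : Lp E 2 μ) :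
    indicatorL2 μ E hs f =ᵐ[μ] s.indicator f := by
  rw [indicatorL2_apply]
  exact MemLp.coeFn_toLp _

theorem isOrthProj_indicatorL2 {s : Set α} (hs : MeasurableSet s) :
    IsOrthProj (indicatorL2 μ E hs) where
  symm f g := by
    rw [L2.inner_def, L2.inner_def]
    refine integral_congr_ae ?_
    filter_upwards [coeFn_indicatorL2 hs f, coeFn_indicatorL2 hs g] with x h1 h2
    rw [h1, h2]
    by_cases h : x ∈ s <;> simp [h]
  idem f := by
    refine Lp.ext ?_
    filter_upwards [coeFn_indicatorL2 hs f, coeFn_indicatorL2 hs (indicatorL2 μ E hs f)] with x h1 h2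
    rw [h2]
    by_cases h : x ∈ s <;> simp [h, h1]

theorem norm_indicatorL2_sq {s : Set α} (hs : MeasurableSet s) (f : Lp E 2 μ) :
    ‖indicatorL2 μ E hs f‖ ^ 2 = ∫ x in s, ‖f x‖ ^ 2 ∂μ := by
  have h := inner_self_eq_norm_sq_to_K (𝕜 := ℂ) (indicatorL2 μ E hs f)
  rw [L2.inner_def] at h
  have h2 : ∫ x, inner ℂ (indicatorL2 μ E hs f x) (indicatorL2 μ E hs f x) ∂μ
      = ((∫ x in s, ‖f x‖ ^ 2 ∂μ : ℝ) : ℂ) := by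
    rw [← integral_indicator hs, ← integral_complex_ofReal]
    refine integral_congr_ae ?_
    filter_upwards [coeFn_indicatorL2 hs f] with x h1
    rw [h1, inner_self_eq_norm_sq_to_K]
    by_cases h : x ∈ s <;> simp [h]
  rw [h2] at h
  exact (Complex.ofReal_injective (by simpa using h)).symm

theorem indicatorL2_univ (f : Lp E 2 μ) : indicatorL2 μ E MeasurableSet.univ f = f := by
  refine Lp.ext ?_
  filter_upwards [coeFn_indicatorL2 MeasurableSet.univ f] with x h1
  simp [h1]

/-- Truncations to an increasing exhaustion converge in `L²`. -/
theorem tendsto_indicatorL2 {s : ℕ → Set α} (hs : ∀ n, MeasurableSet (s n))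
    (hx : ∀ x, ∀ᶠ n in atTop, x ∈ s n) (f : Lp E 2 μ) :
    Tendsto (fun n => indicatorL2 μ E (hs n) f) atTop (𝓝 f) := by
  rw [tendsto_iff_norm_sub_tendsto_zero]
  -- The squared error is the energy outside `s n`, which tends to 0 by dominated convergence with
  -- majorant ‖f‖².
  have h : ∀ n, ‖indicatorL2 μ E (hs n) f - f‖ ^ 2 = ∫ x, (s n)ᶜ.indicator (fun x => ‖f x‖ ^ 2) x ∂μ := by
    intro n
    rw [integral_indicator (hs n).compl, ← norm_indicatorL2_sq (hs n).compl, ← norm_neg]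
    congr 2
    refine Lp.ext ?_
    filter_upwards [coeFn_indicatorL2 (hs n) f, coeFn_indicatorL2 (hs n).compl f,
      Lp.coeFn_neg (indicatorL2 μ E (hs n) f - f), Lp.coeFn_sub (indicatorL2 μ E (hs n) f) f]
      with x h1 h2 h3 h4
    rw [h3, Pi.neg_apply, h4, Pi.sub_apply, h1, h2]
    by_cases h : x ∈ s n <;> simp [h]
  have hsq : Tendsto (fun n => ‖indicatorL2 μ E (hs n) f - f‖ ^ 2) atTop (𝓝 0) := by
    simp_rw [h]
    have hint : Integrable (fun x => ‖f x‖ ^ 2) μ := (Lp.memLp f).integrable_norm_pow two_ne_zero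
    have := tendsto_integral_of_dominated_convergence (μ := μ)
      (F := fun n x => (s n)ᶜ.indicator (fun x => ‖f x‖ ^ 2) x) (f := fun _ => 0) _
      (fun n => (hint.indicator (hs n).compl).aestronglyMeasurable) hint ?_ ?_
    · simpa using this
    · intro n
      refine Eventually.of_forall fun x => ?_
      by_cases h : x ∈ s n <;> simp [h]
    · refine Eventually.of_forall fun x => ?_
      refine tendsto_const_nhds.congr' ?_
      filter_upwards [hx x] with n hn
      simp [hn]
  have := hsq.sqrt
  simpa [Real.sqrt_sq] using this
end Indicator

/-! ### Time- and band-limiting; the sinc kernel -/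

section Plane
open scoped FourierTransform

/-- The Euclidean plane, as the type on which Mathlib's Fourier transform acts. -/
abbrev Plane : Type := WithLp 2 (ℝ × ℝ)

theorem measurableSet_square (a : ℝ) : MeasurableSet (square a) :=
  measurableSet_Icc.prod measurableSet_Icc

theorem isCompact_square (a : ℝ) : IsCompact (square a) :=
  isCompact_Icc.prod isCompact_Icc

theorem measurePreserving_ofLp : MeasurePreserving (WithLp.ofLp : Plane → ℝ × ℝ) :=
  WithLp.volume_preserving_ofLp ℝ ℝ

theorem measurableEmbedding_ofLp : MeasurableEmbedding (WithLp.ofLp : Plane → ℝ × ℝ) :=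
  (MeasurableEquiv.toLp 2 (ℝ × ℝ)).symm.measurableEmbedding

theorem measurePreserving_toLp : MeasurePreserving (WithLp.toLp 2 : ℝ × ℝ → Plane) :=
  measurePreserving_ofLp.symm (MeasurableEquiv.toLp 2 (ℝ × ℝ)).symm

/-- The square `[-a, a]²` in the Euclidean plane. -/
def planeSquare (a : ℝ) : Set Plane := WithLp.ofLp ⁻¹' square a

theorem measurableSet_planeSquare (a : ℝ) : MeasurableSet (planeSquare a) :=
  measurableEmbedding_ofLp.measurable (measurableSet_square a)

theorem isCompact_planeSquare (a : ℝ) : IsCompact (planeSquare a) := by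
  have : planeSquare a = WithLp.toLp 2 '' square a := by
    ext x
    simp only [planeSquare, mem_preimage, mem_image]
    exact ⟨fun h => ⟨_, h, rfl⟩, by rintro ⟨y, hy, rfl⟩; exact hy⟩
  rw [this]
  exact (isCompact_square a).image (WithLp.prod_continuous_toLp 2 ℝ ℝ)

/-- The exponentials carry a factor 2π, so the angular band [-W, W] becomes [-W/2π, W/2π]. At r = 0
the antiderivative degenerates, and the length W/π is the default value of `sincKernel`. -/
theorem integral_exp_mul_I_eq_sinc {W : ℝ} (hW : 0 < W) (r : ℝ) :
    ∫ t in Icc (-(W / (2 * Real.pi))) (W / (2 * Real.pi)),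
      Complex.exp (((2 * Real.pi * (t * r) : ℝ) : ℂ) * Complex.I) = sincKernel W r := by
  have hpi := Real.pi_pos
  rw [integral_Icc_eq_integral_Ioc,
    ← intervalIntegral.integral_of_le (by linarith [(by positivity : 0 < W / (2 * Real.pi))])]
  rcases eq_or_ne r 0 with rfl | hr
  · simp [sincKernel]
    field_simp
    ring
  have hc : (((2 * Real.pi * r : ℝ) : ℂ) * Complex.I) ≠ 0 := by
    simp [hr, hpi.ne']
  have h : ∀ t : ℝ, Complex.exp (((2 * Real.pi * (t * r) : ℝ) : ℂ) * Complex.I) =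
      Complex.exp ((((2 * Real.pi * r : ℝ) : ℂ) * Complex.I) * t) := by
    intro t
    congr 1
    push_cast
    ring
  simp_rw [h]
  rw [integral_exp_mul_complex hc, sincKernel, if_neg hr]
  have e1 : (((2 * Real.pi * r : ℝ) : ℂ) * Complex.I) * ((W / (2 * Real.pi) : ℝ) : ℂ) =
      ((W * r : ℝ) : ℂ) * Complex.I := by
    have : (Real.pi : ℂ) ≠ 0 := by exact_mod_cast hpi.ne'
    push_cast
    field_simp
  have e2 : (((2 * Real.pi * r : ℝ) : ℂ) * Complex.I) * ((-(W / (2 * Real.pi)) : ℝ) : ℂ) =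
      -(((W * r : ℝ) : ℂ) * Complex.I) := by
    rw [← e1]; push_cast; ring
  rw [e1, e2, Complex.ofReal_div, Complex.ofReal_sin, Complex.sin, neg_mul]
  have hr' : (r : ℂ) ≠ 0 := by exact_mod_cast hr
  have hpi' : (Real.pi : ℂ) ≠ 0 := by exact_mod_cast hpi.ne'
  push_cast
  field_simp
  rw [Complex.I_sq]
  ring

theorem integral_planeSquare_exp {W : ℝ} (hW : 0 < W) (x : Plane) :
    ∫ w in planeSquare (W / (2 * Real.pi)),
      Complex.exp (((2 * Real.pi * inner ℝ w x : ℝ) : ℂ) * Complex.I) =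
      ((sincKernel W x.fst * sincKernel W x.snd : ℝ) : ℂ) := by
  have h := measurePreserving_ofLp.setIntegral_preimage_emb measurableEmbedding_ofLp
    (fun w : ℝ × ℝ => Complex.exp (((2 * Real.pi * (w.1 * x.fst) : ℝ) : ℂ) * Complex.I) *
      Complex.exp (((2 * Real.pi * (w.2 * x.snd) : ℝ) : ℂ) * Complex.I))
      (square (W / (2 * Real.pi)))
  rw [square, Measure.volume_eq_prod,
    setIntegral_prod_mul
      (fun t : ℝ => Complex.exp (((2 * Real.pi * (t * x.fst) : ℝ) : ℂ) * Complex.I))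
      (fun t : ℝ => Complex.exp (((2 * Real.pi * (t * x.snd) : ℝ) : ℂ) * Complex.I)),
    integral_exp_mul_I_eq_sinc hW, integral_exp_mul_I_eq_sinc hW] at h
  rw [Complex.ofReal_mul, ← h]
  refine setIntegral_congr_fun (measurableSet_planeSquare _) fun w _ => ?_
  rw [← Complex.exp_add, WithLp.prod_inner_apply]
  congr 1
  simp
  ring

variable {E : Type*} [NormedAddCommGroup E]

theorem integrable_indicator_planeSquare (T : ℝ) (f : Lp E 2 (volume : Measure Plane)) :
    Integrable ((planeSquare T).indicator f) := by
  rw [integrable_indicator_iff (measurableSet_planeSquare T)]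
  have : IsFiniteMeasure (volume.restrict (planeSquare T)) :=
    ⟨by simpa using (isCompact_planeSquare T).measure_lt_top⟩
  exact ((Lp.memLp f).restrict _).integrable one_le_two

variable [InnerProductSpace ℂ E]

/-- The time-limiting projection. -/
noncomputable def timeProj (E : Type*) [NormedAddCommGroup E] [InnerProductSpace ℂ E] (T : ℝ) :
    Lp E 2 (volume : Measure Plane) →L[ℂ] Lp E 2 (volume : Measure Plane) :=
  indicatorL2 volume E (measurableSet_planeSquare T)

theorem isOrthProj_timeProj (T : ℝ) : IsOrthProj (timeProj E T) :=
  isOrthProj_indicatorL2 _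

variable [CompleteSpace E]

/-- The band-limiting projection. -/
noncomputable def bandProj (E : Type*) [NormedAddCommGroup E] [InnerProductSpace ℂ E]
    [CompleteSpace E] (W : ℝ) :
    Lp E 2 (volume : Measure Plane) →L[ℂ] Lp E 2 (volume : Measure Plane) :=
  ((Lp.fourierTransformₗᵢ Plane E).symm : Lp E 2 (volume : Measure Plane) →L[ℂ] _) ∘L
    indicatorL2 volume E (measurableSet_planeSquare (W / (2 * Real.pi))) ∘L
    (Lp.fourierTransformₗᵢ Plane E : Lp E 2 (volume : Measure Plane) →L[ℂ] _)

theorem bandProj_apply (W : ℝ) (f : Lp E 2 (volume : Measure Plane)) :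
    bandProj E W f =
      𝓕⁻ (indicatorL2 volume E (measurableSet_planeSquare (W / (2 * Real.pi))) (𝓕 f)) := rfl

theorem isOrthProj_bandProj (W : ℝ) : IsOrthProj (bandProj E W) where
  symm f g := by
    rw [bandProj_apply, bandProj_apply, ← Lp.inner_fourier_eq, ← Lp.inner_fourier_eq f,
      FourierTransform.fourier_fourierInv_eq, FourierTransform.fourier_fourierInv_eq]
    exact (isOrthProj_indicatorL2 _).symm _ _
  idem f := by
    rw [bandProj_apply, bandProj_apply, FourierTransform.fourier_fourierInv_eq,
      (isOrthProj_indicatorL2 _).idem]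

theorem norm_bandProj_sq (W : ℝ) (f : Lp E 2 (volume : Measure Plane)) :
    ‖bandProj E W f‖ ^ 2 =
      ∫ w in planeSquare (W / (2 * Real.pi)), ‖(𝓕 f : Lp E 2 (volume : Measure Plane)) w‖ ^ 2 := by
  rw [bandProj_apply, ← Lp.norm_fourier_eq, FourierTransform.fourier_fourierInv_eq,
    norm_indicatorL2_sq]

theorem fourier_timeProj_ae_eq (T : ℝ) (f : Lp E 2 (volume : Measure Plane)) :
    (𝓕 (timeProj E T f) : Lp E 2 (volume : Measure Plane)) =ᵐ[volume]
      𝓕 ((planeSquare T).indicator f) := by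
  rw [timeProj, indicatorL2_apply]
  exact fourier_toLp_two_ae_eq (integrable_indicator_planeSquare T f) _

/-- Fubini, with integrand dominated by ‖f s‖ over a bounded frequency square; the inner integral
over frequencies is the product of sinc kernels. -/
theorem fourierInv_indicator_fourier {f : Plane → E} (hf : Integrable f) {W : ℝ} (hW : 0 < W)
    (x : Plane) :
    𝓕⁻ ((planeSquare (W / (2 * Real.pi))).indicator (𝓕 f)) x =
      ∫ s, (sincKernel W (x.fst - s.fst) * sincKernel W (x.snd - s.snd)) • f s := by
  have hms := measurableSet_planeSquare (W / (2 * Real.pi))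
  have : IsFiniteMeasure (volume.restrict (planeSquare (W / (2 * Real.pi)))) :=
    ⟨by simpa using (isCompact_planeSquare _).measure_lt_top⟩
  have h1 : 𝓕⁻ ((planeSquare (W / (2 * Real.pi))).indicator (𝓕 f)) x =
      ∫ w in planeSquare (W / (2 * Real.pi)),
        ∫ s, Complex.exp (((2 * Real.pi * inner ℝ w (x - s) : ℝ) : ℂ) * Complex.I) • f s := by
    rw [Real.fourierInv_eq', ← integral_indicator hms]
    congr 1 with w
    by_cases hw : w ∈ planeSquare (W / (2 * Real.pi))
    · rw [indicator_of_mem hw, indicator_of_mem hw, Real.fourier_eq', ← integral_smul]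
      congr 1 with s
      rw [smul_smul, ← Complex.exp_add, inner_sub_right, real_inner_comm w s]
      congr 2
      push_cast
      ring
    · rw [indicator_of_notMem hw, indicator_of_notMem hw, smul_zero]
  rw [h1, integral_integral_swap]
  · congr 1 with s
    rw [integral_smul_const, integral_planeSquare_exp hW, Complex.coe_smul]
    rfl
  · have : Integrable (fun p : Plane × Plane => (1 : ℝ) • f p.2)
        ((volume.restrict (planeSquare (W / (2 * Real.pi)))).prod volume) :=
      (integrable_const (1 : ℝ)).smul_prod hf
    refine this.mono ?_ ?_
    · refine AEStronglyMeasurable.smul ?_ hf.aestronglyMeasurable.comp_snd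
      exact Continuous.aestronglyMeasurable (by fun_prop)
    · refine Eventually.of_forall fun p => ?_
      rw [one_smul, Function.uncurry, norm_smul, Complex.norm_exp_ofReal_mul_I, one_mul]

/-- Identifies QP with the operator of the integral equation. Both cut-offs produce integrable
functions, so the two L² transforms may be computed as integrals. -/
theorem bandProj_timeProj_ae_eq (T : ℝ) {W : ℝ} (hW : 0 < W)
    (f : Lp E 2 (volume : Measure Plane)) :
    bandProj E W (timeProj E T f) =ᵐ[volume] fun x => ∫ s in planeSquare T,
      (sincKernel W (x.fst - s.fst) * sincKernel W (x.snd - s.snd)) • f s := by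
  have hint := integrable_indicator_planeSquare T f
  have hΩ := measurableSet_planeSquare (W / (2 * Real.pi))
  have hm1 : Integrable ((planeSquare (W / (2 * Real.pi))).indicator
      (𝓕 ((planeSquare T).indicator f))) := by
    rw [integrable_indicator_iff hΩ]
    exact (continuous_fourier_of_integrable hint).continuousOn.integrableOn_compact
      (isCompact_planeSquare _)
  have hae : indicatorL2 volume E hΩ (𝓕 (timeProj E T f)) =ᵐ[volume]
      (planeSquare (W / (2 * Real.pi))).indicator (𝓕 ((planeSquare T).indicator f)) := by
    filter_upwards [coeFn_indicatorL2 hΩ (𝓕 (timeProj E T f)), fourier_timeProj_ae_eq T f]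
      with w h1 h2
    rw [h1]
    simp only [indicator, h2]
  have hm2 := (memLp_congr_ae hae).1 (Lp.memLp _)
  have heq : indicatorL2 volume E hΩ (𝓕 (timeProj E T f)) = hm2.toLp _ := by
    rw [← Lp.toLp_coeFn (indicatorL2 volume E hΩ (𝓕 (timeProj E T f))) (Lp.memLp _)]
    exact (MemLp.toLp_eq_toLp_iff _ _).2 hae
  rw [bandProj_apply, heq]
  filter_upwards [fourierInv_toLp_two_ae_eq hm1 hm2] with x hx
  rw [hx, fourierInv_indicator_fourier hint hW, ← integral_indicator (measurableSet_planeSquare T)]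
  congr 1 with s
  by_cases hs : s ∈ planeSquare T <;> simp [hs]

end Plane

/-! ### Weak compactness: the norm of QP is attained and nonzero -/

theorem exists_subseq_tendsto_inner {H : Type*} [NormedAddCommGroup H] [InnerProductSpace ℂ H]
    [CompleteSpace H] [TopologicalSpace.SeparableSpace H] {x : ℕ → H} (hx : ∀ n, ‖x n‖ ≤ 1) :
    ∃ a : H, ‖a‖ ≤ 1 ∧ ∃ φ : ℕ → ℕ, StrictMono φ ∧
      ∀ y : H, Tendsto (fun n => inner ℂ y (x (φ n))) atTop (𝓝 (inner ℂ y a)) := by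
  let u : ℕ → WeakDual ℂ H := fun n =>
    StrongDual.toWeakDual (InnerProductSpace.toDual ℂ H (x n))
  have hu : ∀ n, u n ∈ WeakDual.toStrongDual ⁻¹' Metric.closedBall (0 : StrongDual ℂ H) 1 := by
    intro n
    rw [mem_preimage, mem_closedBall_zero_iff]
    change ‖InnerProductSpace.toDual ℂ H (x n)‖ ≤ 1
    rw [LinearIsometryEquiv.norm_map]
    exact hx n
  -- Sequential Banach–Alaoglu in the dual, which Riesz identifies with `H`; separability supplies
  -- the subsequence.
  obtain ⟨b, hb, φ, hφ, hlim⟩ := WeakDual.isSeqCompact_closedBall ℂ H 0 1 hu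
  refine ⟨(InnerProductSpace.toDual ℂ H).symm (WeakDual.toStrongDual b), ?_, φ, hφ, fun y => ?_⟩
  · rw [LinearIsometryEquiv.norm_map]
    simpa using hb
  · have h1 := ((WeakBilin.eval_continuous (topDualPairing ℂ H) y).tendsto b).comp hlim
    have h2 := (Complex.continuous_conj.tendsto _).comp h1
    rw [← inner_conj_symm, InnerProductSpace.toDual_symm_apply]
    refine (h2.congr fun n => ?_)
    rw [← inner_conj_symm]
    rfl

section Plane
open scoped FourierTransform

variable {E : Type*} [NormedAddCommGroup E] [InnerProductSpace ℂ E]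

/-- The functions `v ↦ e^{2πi⟨v, w⟩} y` cut off to a square: the Fourier transforms of time-limited
signals are inner products with them. -/
noncomputable def cutoffExp (T : ℝ) (w : Plane) (y : E) : Plane → E :=
  (planeSquare T).indicator
    fun v => Complex.exp (((2 * Real.pi * inner ℝ v w : ℝ) : ℂ) * Complex.I) • y

theorem norm_cutoffExp (T : ℝ) (w : Plane) (y : E) (v : Plane) :
    ‖cutoffExp T w y v‖ = ‖(planeSquare T).indicator (fun _ => y) v‖ := by
  by_cases h : v ∈ planeSquare T
  · rw [cutoffExp, indicator_of_mem h, indicator_of_mem h, norm_smul,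
      Complex.norm_exp_ofReal_mul_I, one_mul]
  · rw [cutoffExp, indicator_of_notMem h, indicator_of_notMem h]

theorem memLp_cutoffExp (T : ℝ) (w : Plane) (y : E) : MemLp (cutoffExp T w y) 2 := by
  refine (memLp_indicator_const 2 (measurableSet_planeSquare T) y
    (Or.inr (isCompact_planeSquare T).measure_lt_top.ne)).of_le ?_
    (Eventually.of_forall fun v => (norm_cutoffExp T w y v).le)
  exact (Continuous.aestronglyMeasurable (by fun_prop)).indicator (measurableSet_planeSquare T)

/-- Evaluating the transform of a time-limited signal at a point is a bounded functional on L², so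
weak convergence of signals forces pointwise convergence of these transforms. -/
theorem inner_cutoffExp [CompleteSpace E] (T : ℝ) (w : Plane) (y : E) (f : Lp E 2 (volume : Measure Plane)) :
    inner ℂ ((memLp_cutoffExp T w y).toLp _) f =
      inner ℂ y (𝓕 ((planeSquare T).indicator f) w) := by
  have hint := integrable_indicator_planeSquare T f
  rw [Real.fourier_eq', ← integral_inner, L2.inner_def]
  · refine integral_congr_ae ?_
    filter_upwards [(memLp_cutoffExp T w y).coeFn_toLp] with v hv
    rw [hv, cutoffExp]
    by_cases h : v ∈ planeSquare T
    · rw [indicator_of_mem h, indicator_of_mem h, inner_smul_left, inner_smul_right,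
        ← Complex.exp_conj]
      congr 2
      rw [map_mul, Complex.conj_ofReal, Complex.conj_I]
      push_cast
      ring
    · simp [indicator_of_notMem h]
  · refine hint.norm.mono' ?_ (Eventually.of_forall fun v => ?_)
    · exact (Continuous.aestronglyMeasurable (by fun_prop)).smul hint.aestronglyMeasurable
    · rw [norm_smul, Complex.norm_exp_ofReal_mul_I, one_mul]

theorem exists_norm_fourier_indicator_le [CompleteSpace E] (T : ℝ) :
    ∃ C : ℝ, ∀ (f : Lp E 2 (volume : Measure Plane)) (w : Plane),
      ‖𝓕 ((planeSquare T).indicator f) w‖ ≤ C * ‖f‖ := by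
  have hs := measurableSet_planeSquare T
  have hfin : volume (planeSquare T) ≠ ⊤ := (isCompact_planeSquare T).measure_lt_top.ne
  refine ⟨(volume.real (planeSquare T)) ^ (1 / ENNReal.toReal 2), fun f w => ?_⟩
  -- Testing against the value itself makes the inner product ‖y‖², and one factor ‖y‖ then cancels.
  set y := 𝓕 ((planeSquare T).indicator f) w with hy
  have h1 : ‖y‖ ^ 2 ≤ ‖(memLp_cutoffExp T w y).toLp _‖ * ‖f‖ := by
    have := norm_inner_le_norm (𝕜 := ℂ) ((memLp_cutoffExp T w y).toLp _) f
    rw [inner_cutoffExp, ← hy, inner_self_eq_norm_sq_to_K] at this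
    simpa using this
  have h2 : ‖(memLp_cutoffExp T w y).toLp _‖ ≤
      ‖y‖ * (volume.real (planeSquare T)) ^ (1 / ENNReal.toReal 2) := by
    rw [← norm_indicatorConstLp (hs := hs) (hμs := hfin) two_ne_zero ENNReal.ofNat_ne_top]
    refine Lp.norm_le_norm_of_ae_le ?_
    filter_upwards [(memLp_cutoffExp T w y).coeFn_toLp,
      indicatorConstLp_coeFn (p := 2) (hs := hs) (hμs := hfin) (c := y)] with v hv hv'
    rw [hv, hv', norm_cutoffExp]
  rcases eq_or_ne ‖y‖ 0 with h | h
  · rw [h]; positivity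
  · have hp : 0 < ‖y‖ := lt_of_le_of_ne (norm_nonneg _) h.symm
    have h3 := h1.trans (mul_le_mul_of_nonneg_right h2 (norm_nonneg f))
    rw [pow_two, mul_assoc] at h3
    exact le_of_mul_le_mul_left h3 hp

variable [CompleteSpace E]

theorem norm_bandProj_timeProj_sq (T W : ℝ) (f : Lp E 2 (volume : Measure Plane)) :
    ‖bandProj E W (timeProj E T f)‖ ^ 2 =
      ∫ w in planeSquare (W / (2 * Real.pi)), ‖𝓕 ((planeSquare T).indicator f) w‖ ^ 2 := by
  rw [norm_bandProj_sq]
  refine integral_congr_ae (ae_restrict_of_ae ?_)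
  filter_upwards [fourier_timeProj_ae_eq T f] with w hw
  rw [hw]

/-- Along a weakly convergent maximizing sequence the transforms converge pointwise and are
uniformly bounded. On the bounded frequency square, dominated convergence then carries ‖QPx‖² to the
limit. -/
theorem exists_norm_bandProj_timeProj_eq [FiniteDimensional ℂ E] (T W : ℝ) :
    ∃ f : Lp E 2 (volume : Measure Plane), ‖f‖ ≤ 1 ∧
      ‖(bandProj E W ∘L timeProj E T) f‖ = ‖bandProj E W ∘L timeProj E T‖ := by
  set A := bandProj E W ∘L timeProj E T with hA
  have hsep : TopologicalSpace.SeparableSpace E := by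
    have := FiniteDimensional.proper ℂ E
    infer_instance
  have htwo : Fact ((2 : ENNReal) ≠ ⊤) := ⟨ENNReal.ofNat_ne_top⟩
  have hlt : ∀ n : ℕ, ‖A‖ - 1 / ((n : ℝ) + 1) < ‖A‖ := fun n => by
    linarith [Nat.one_div_pos_of_nat (α := ℝ) (n := n)]
  choose x hx1 hx2 using fun n => A.exists_lt_apply_of_lt_opNorm (hlt n)
  have hxlim : Tendsto (fun n => ‖A (x n)‖) atTop (𝓝 ‖A‖) := by
    refine tendsto_of_tendsto_of_tendsto_of_le_of_le (g := fun n : ℕ => ‖A‖ - 1 / ((n : ℝ) + 1))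
      ?_ tendsto_const_nhds (fun n => (hx2 n).le) fun n => ?_
    · simpa using tendsto_const_nhds.sub (tendsto_one_div_add_atTop_nhds_zero_nat (𝕜 := ℝ))
    · exact A.unit_le_opNorm _ (hx1 n).le
  obtain ⟨a, ha, φ, hφ, hweak⟩ := exists_subseq_tendsto_inner fun n => (hx1 n).le
  obtain ⟨C, hC⟩ := exists_norm_fourier_indicator_le (E := E) T
  refine ⟨a, ha, ?_⟩
  have hpt : ∀ w, Tendsto (fun n => 𝓕 ((planeSquare T).indicator (x (φ n))) w) atTop
      (𝓝 (𝓕 ((planeSquare T).indicator a) w)) := by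
    intro w
    -- Weak convergence controls one coordinate at a time; finite dimension upgrades this to
    -- convergence in `E`.
    let b := stdOrthonormalBasis ℂ E
    have : ∀ i, Tendsto (fun n => inner ℂ (b i) (𝓕 ((planeSquare T).indicator (x (φ n))) w) • b i)
        atTop (𝓝 (inner ℂ (b i) (𝓕 ((planeSquare T).indicator a) w) • b i)) := by
      intro i
      simp_rw [← inner_cutoffExp]
      exact (hweak _).smul_const _
    have h2 := tendsto_finsetSum Finset.univ fun i _ => this i
    simpa only [b.sum_repr'] using h2
  have hfin : IsFiniteMeasure (volume.restrict (planeSquare (W / (2 * Real.pi)))) :=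
    ⟨by simpa using (isCompact_planeSquare _).measure_lt_top⟩
  have hlim : Tendsto (fun n => ‖A (x (φ n))‖ ^ 2) atTop (𝓝 (‖A a‖ ^ 2)) := by
    simp_rw [hA, ContinuousLinearMap.comp_apply, norm_bandProj_timeProj_sq]
    refine tendsto_integral_of_dominated_convergence (fun _ => |C| ^ 2) (fun n => ?_)
      (integrable_const _) (fun n => Eventually.of_forall fun w => ?_)
      (Eventually.of_forall fun w => ((hpt w).norm.pow 2))
    · exact ((continuous_fourier_of_integrable
        (integrable_indicator_planeSquare T _)).norm.pow 2).aestronglyMeasurable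
    · rw [norm_pow, norm_norm]
      gcongr
      refine (hC _ _).trans ((mul_le_mul_of_nonneg_right (le_abs_self C) (norm_nonneg _)).trans ?_)
      exact mul_le_of_le_one_right (abs_nonneg C) (hx1 _).le
  have h3 := tendsto_nhds_unique hlim ((hxlim.comp hφ.tendsto_atTop).pow 2)
  exact (sq_eq_sq₀ (norm_nonneg _) (norm_nonneg _)).1 h3

/-- If QP vanished, the continuous transform of a constant cut off to the time square would vanish
near 0, yet its value at 0 is that constant times the positive area. -/
theorem bandProj_comp_timeProj_ne_zero [Nontrivial E] {T W : ℝ} (hT : 0 < T) (hW : 0 < W) :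
    bandProj E W ∘L timeProj E T ≠ 0 := by
  intro h0
  obtain ⟨e, he⟩ := exists_ne (0 : E)
  have hsub : ∀ a : ℝ, 0 < a → ∃ U ⊆ planeSquare a, IsOpen U ∧ (0 : Plane) ∈ U := by
    intro a ha
    refine ⟨WithLp.ofLp ⁻¹' (Ioo (-a) a ×ˢ Ioo (-a) a), ?_, ?_, ?_⟩
    · exact preimage_mono (prod_mono Ioo_subset_Icc_self Ioo_subset_Icc_self)
    · exact (isOpen_Ioo.prod isOpen_Ioo).preimage (WithLp.prod_continuous_ofLp 2 ℝ ℝ)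
    · simp [ha]
  have hs := measurableSet_planeSquare T
  have hfin : volume (planeSquare T) ≠ ⊤ := (isCompact_planeSquare T).measure_lt_top.ne
  let f : Lp E 2 (volume : Measure Plane) := indicatorConstLp 2 hs hfin e
  have hf : (planeSquare T).indicator f =ᵐ[volume] (planeSquare T).indicator fun _ => e := by
    filter_upwards [indicatorConstLp_coeFn (p := 2) (hs := hs) (hμs := hfin) (c := e)] with v hv
    by_cases h : v ∈ planeSquare T
    · rw [indicator_of_mem h, hv]
    · simp [h]
  set F := 𝓕 ((planeSquare T).indicator f) with hF
  have hFc : Continuous F :=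
    continuous_fourier_of_integrable (integrable_indicator_planeSquare T f)
  have hint : ∫ w in planeSquare (W / (2 * Real.pi)), ‖F w‖ ^ 2 = 0 := by
    rw [← norm_bandProj_timeProj_sq, ← ContinuousLinearMap.comp_apply, h0]
    simp
  obtain ⟨U, hU, hUo, hU0⟩ := hsub (W / (2 * Real.pi)) (by positivity)
  have hFi : IntegrableOn (fun w => ‖F w‖ ^ 2) (planeSquare (W / (2 * Real.pi))) :=
    (hFc.norm.pow 2).continuousOn.integrableOn_compact (isCompact_planeSquare _)
  rw [integral_eq_zero_iff_of_nonneg (fun _ => by positivity) hFi] at hint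
  have hae : F =ᵐ[volume.restrict U] fun _ => 0 := by
    filter_upwards [ae_restrict_of_ae_restrict_of_subset hU hint] with w hw
    simpa using hw
  have hF0 := Measure.eqOn_open_of_ae_eq hae hUo hFc.continuousOn continuousOn_const hU0
  rw [hF, Real.fourier_congr_ae hf, Real.fourier_eq] at hF0
  simp only [inner_zero_right, neg_zero, AddChar.map_zero_eq_one, one_smul] at hF0
  rw [integral_indicator hs, setIntegral_const, smul_eq_zero] at hF0
  rcases hF0 with h | h
  · obtain ⟨U', hU', hUo', hU0'⟩ := hsub T hT
    have := (hUo'.measure_pos volume ⟨0, hU0'⟩).trans_le (measure_mono hU')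
    rw [measureReal_def, ENNReal.toReal_eq_zero_iff] at h
    exact h.elim this.ne' hfin
  · exact he h

end Plane

/-! ### Splitting the two-sided kernel into complex exponentials -/

section Algebra

/-- `ℂ⁴`, the complexification of the quaternions. -/
abbrev C4 : Type := EuclideanSpace ℂ (Fin 4)

/-- The quaternion with given real components. -/
def quat (a b c d : ℝ) : ℍ[ℝ] := ⟨a, b, c, d⟩

@[simp] theorem re_quat (a b c d : ℝ) : (quat a b c d).re = a := rfl
@[simp] theorem imI_quat (a b c d : ℝ) : (quat a b c d).imI = b := rfl
@[simp] theorem imJ_quat (a b c d : ℝ) : (quat a b c d).imJ = c := rfl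
@[simp] theorem imK_quat (a b c d : ℝ) : (quat a b c d).imK = d := rfl

theorem expI_eq_quat (θ : ℝ) : expI θ = quat (Real.cos θ) (Real.sin θ) 0 0 := rfl
theorem expJ_eq_quat (θ : ℝ) : expJ θ = quat (Real.cos θ) 0 (Real.sin θ) 0 := rfl

theorem quaternion_norm_sq (q : ℍ[ℝ]) :
    ‖q‖ ^ 2 = q.re ^ 2 + q.imI ^ 2 + q.imJ ^ 2 + q.imK ^ 2 := by
  rw [pow_two, ← Quaternion.normSq_eq_norm_mul_self, Quaternion.normSq_def']

/-- The real components of a quaternion, as a vector in `ℂ⁴`. -/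
noncomputable def complexify : ℍ[ℝ] →ₗᵢ[ℝ] C4 where
  toFun q := !₂[(q.re : ℂ), (q.imI : ℂ), (q.imJ : ℂ), (q.imK : ℂ)]
  map_add' p q := by ext i; fin_cases i <;> simp
  map_smul' c q := by ext i; fin_cases i <;> simp
  norm_map' q := by
    rw [← sq_eq_sq₀ (norm_nonneg _) (norm_nonneg _), EuclideanSpace.norm_sq_eq, quaternion_norm_sq]
    simp [Fin.sum_univ_four]

theorem complexify_apply (q : ℍ[ℝ]) :
    complexify q = !₂[(q.re : ℂ), (q.imI : ℂ), (q.imJ : ℂ), (q.imK : ℂ)] := rfl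

/-- The quaternion of the real parts of a vector in `ℂ⁴`. -/
noncomputable def realPart : C4 →L[ℝ] ℍ[ℝ] :=
  LinearMap.toContinuousLinearMap
    { toFun := fun z => quat (z 0).re (z 1).re (z 2).re (z 3).re
      map_add' := fun z w => by ext <;> simp
      map_smul' := fun c z => by ext <;> simp }

theorem realPart_apply (z : C4) : realPart z = quat (z 0).re (z 1).re (z 2).re (z 3).re := rfl

/-- The quaternion of the imaginary parts of a vector in `ℂ⁴`. -/
noncomputable def imagPart : C4 →L[ℝ] ℍ[ℝ] :=
  LinearMap.toContinuousLinearMap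
    { toFun := fun z => quat (z 0).im (z 1).im (z 2).im (z 3).im
      map_add' := fun z w => by ext <;> simp
      map_smul' := fun c z => by ext <;> simp }

theorem imagPart_apply (z : C4) : imagPart z = quat (z 0).im (z 1).im (z 2).im (z 3).im := rfl

theorem eq_zero_of_realPart_imagPart {z : C4} (h1 : realPart z = 0) (h2 : imagPart z = 0) :
    z = 0 := by
  rw [realPart_apply, Quaternion.ext_iff] at h1
  rw [imagPart_apply, Quaternion.ext_iff] at h2
  ext i
  fin_cases i <;> apply Complex.ext <;> simp_all

/-- The map `½ (z - s i z j)` from `ℂ` to the quaternions. -/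
noncomputable def splitPart (s : ℝ) : ℂ →ₗ[ℝ] ℍ[ℝ] where
  toFun z := quat (z.re / 2) (z.im / 2) (s * z.im / 2) (-(s * z.re / 2))
  map_add' z w := by ext <;> simp <;> ring
  map_smul' c z := by ext <;> simp <;> ring

theorem splitPart_apply (s : ℝ) (z : ℂ) :
    splitPart s z = quat (z.re / 2) (z.im / 2) (s * z.im / 2) (-(s * z.re / 2)) := rfl

/-- The assembly of one half of the two-sided quaternionic Fourier transform from the complex
Fourier transforms of the four components. -/
noncomputable def assemble (s : ℝ) : C4 →L[ℝ] ℍ[ℝ] :=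
  LinearMap.toContinuousLinearMap
    { toFun := fun z => splitPart s (z 0) + quat 0 1 0 0 * splitPart s (z 1) +
        splitPart s (z 2) * quat 0 0 1 0 + quat 0 1 0 0 * splitPart s (z 3) * quat 0 0 1 0
      map_add' := fun z w => by
        simp only [PiLp.add_apply, map_add, mul_add, add_mul]; abel
      map_smul' := fun c z => by
        simp only [PiLp.smul_apply, map_smul, mul_smul_comm, smul_mul_assoc, smul_add,
          RingHom.id_apply] }

theorem assemble_apply (s : ℝ) (z : C4) :
    assemble s z = splitPart s (z 0) + quat 0 1 0 0 * splitPart s (z 1) +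
        splitPart s (z 2) * quat 0 0 1 0 + quat 0 1 0 0 * splitPart s (z 3) * quat 0 0 1 0 := rfl

/-- `splitPart s z` is z·½(1 - sk), and ½(1 - sk) turns e^{-jb} on its right into e^{-isb} on its
left. Writing q = q₀ + iq₁ + q₂j + iq₃j, the outer units commute with the exponential on their own
side, which dictates the shape of `assemble`. -/
theorem expI_mul_mul_expJ (a b : ℝ) (q : ℍ[ℝ]) :
    expI (-a) * q * expJ (-b) =
      assemble 1 (Complex.exp (((-(a + b) : ℝ) : ℂ) * Complex.I) • complexify q) +
      assemble (-1) (Complex.exp (((-(a - b) : ℝ) : ℂ) * Complex.I) • complexify q) := by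
  rw [assemble_apply, assemble_apply]
  ext <;> simp [expI_eq_quat, expJ_eq_quat, splitPart_apply, complexify_apply, Complex.exp_re, Complex.exp_im, Real.cos_add, Real.sin_add,
      sub_eq_add_neg] <;> ring

/-- The coordinate projections of `ℂ⁴`, followed by the inclusion as first coordinate axis. -/
noncomputable def coordToFirst (m : Fin 4) : C4 →L[ℂ] C4 :=
  LinearMap.toContinuousLinearMap
    { toFun := fun z => EuclideanSpace.single 0 (z m)
      map_add' := fun z w => by ext i; fin_cases i <;> simp
      map_smul' := fun c z => by ext i; fin_cases i <;> simp }

theorem coordToFirst_apply (m : Fin 4) (z : C4) :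
    coordToFirst m z = EuclideanSpace.single 0 (z m) := rfl

/-- The halves z·½(1 - k) and w·½(1 + k) are orthogonal, with squared norms |z|²/2 and |w|²/2. A
real signal occupies only the first coordinate, hence `coordToFirst`. -/
theorem norm_sq_assemble_add (m : Fin 4) (z w : C4) :
    ‖assemble 1 (coordToFirst m z) + assemble (-1) (coordToFirst m w)‖ ^ 2 =
      (‖z m‖ ^ 2 + ‖w m‖ ^ 2) / 2 := by
  rw [quaternion_norm_sq, assemble_apply, assemble_apply, Complex.sq_norm, Complex.sq_norm, Complex.normSq_apply,
    Complex.normSq_apply]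
  simp [coordToFirst_apply, splitPart_apply]
  ring
end Algebra

/-! ### Passing between the two Fourier normalizations -/

section Scaling

/-- The dilation of the plane that relates the two normalizations of the Fourier transform. -/
noncomputable def dilate (w : ℝ × ℝ) : Plane := WithLp.toLp 2 ((2 * Real.pi)⁻¹ • w)

theorem measurableEmbedding_dilate : MeasurableEmbedding dilate := by
  have h : (2 * Real.pi)⁻¹ ≠ 0 := by positivity
  exact (MeasurableEquiv.toLp 2 (ℝ × ℝ)).measurableEmbedding.comp
    (Homeomorph.smulOfNeZero _ h).measurableEmbedding

theorem map_dilate :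
    Measure.map dilate volume = ENNReal.ofReal ((2 * Real.pi) ^ 2) • (volume : Measure Plane) := by
  have h : (2 * Real.pi)⁻¹ ≠ 0 := by positivity
  have h1 : Measure.map ((2 * Real.pi)⁻¹ • · : ℝ × ℝ → ℝ × ℝ) volume =
      ENNReal.ofReal ((2 * Real.pi) ^ 2) • volume := by
    rw [Measure.map_addHaar_smul _ h]
    congr 2
    rw [Module.finrank_prod, Module.finrank_self, inv_pow, inv_inv, abs_of_pos (by positivity)]
  have h2 : dilate = (WithLp.toLp 2) ∘ ((2 * Real.pi)⁻¹ • · : ℝ × ℝ → ℝ × ℝ) := rfl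
  rw [h2, ← Measure.map_map measurePreserving_toLp.measurable (by fun_prop), h1,
    Measure.map_smul, measurePreserving_toLp.map_eq]

theorem quasiMeasurePreserving_dilate : Measure.QuasiMeasurePreserving dilate volume volume :=
  ⟨measurableEmbedding_dilate.measurable, by
    rw [map_dilate]; exact Measure.smul_absolutelyContinuous⟩

theorem preimage_dilate_planeSquare (W : ℝ) :
    dilate ⁻¹' planeSquare (W / (2 * Real.pi)) = square W := by
  have h : 0 < (2 * Real.pi)⁻¹ := by positivity
  ext w
  simp only [dilate, planeSquare, square, mem_preimage, mem_prod, mem_Icc, Prod.smul_fst,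
    Prod.smul_snd, smul_eq_mul, div_eq_inv_mul, ← mul_neg, mul_le_mul_iff_right₀ h]

/-- The unitary rescaling of an `L²` function by the dilation `dilate`. -/
noncomputable def rescale (F : Plane → C4) (w : ℝ × ℝ) : C4 := (2 * Real.pi)⁻¹ • F (dilate w)

/-- The squared amplitude factor (2π)⁻² cancels the Jacobian (2π)² of the dilation. -/
theorem setIntegral_norm_rescale_sq (F : Plane → C4) (s : Set Plane) :
    ∫ w in dilate ⁻¹' s, ‖rescale F w‖ ^ 2 = ∫ v in s, ‖F v‖ ^ 2 := by
  have h := measurableEmbedding_dilate.setIntegral_map (μ := volume) (fun v => ‖F v‖ ^ 2) s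
  rw [map_dilate, Measure.restrict_smul, integral_smul_measure,
    ENNReal.toReal_ofReal (by positivity)] at h
  simp_rw [rescale, norm_smul, mul_pow]
  rw [integral_const_mul, ← h, norm_inv, Real.norm_of_nonneg (by positivity), smul_eq_mul]
  field_simp

theorem eLpNorm_rescale {F : Plane → C4} (hF : AEStronglyMeasurable F) :
    eLpNorm (rescale F) 2 volume = eLpNorm F 2 volume := by
  have h : eLpNorm (rescale F) 2 volume = ‖(2 * Real.pi)⁻¹‖ₑ * eLpNorm (F ∘ dilate) 2 volume :=
    eLpNorm_const_smul (2 * Real.pi)⁻¹ (F ∘ dilate) 2 volume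
  rw [h, ← eLpNorm_map_measure _ measurableEmbedding_dilate.measurable.aemeasurable, map_dilate,
    eLpNorm_smul_measure_of_ne_top ENNReal.ofNat_ne_top, smul_eq_mul, ← mul_assoc]
  · have : ‖(2 * Real.pi)⁻¹‖ₑ * ENNReal.ofReal ((2 * Real.pi) ^ 2) ^
        (1 / 2 : ENNReal).toReal = 1 := by
      rw [ENNReal.toReal_div, ENNReal.toReal_one, ENNReal.ofReal_rpow_of_nonneg (by positivity) (by positivity),
        Real.enorm_eq_ofReal (by positivity),
        ← ENNReal.ofReal_mul (by positivity), ENNReal.toReal_ofNat, ← Real.sqrt_eq_rpow,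
        Real.sqrt_sq (by positivity), inv_mul_cancel₀ (by positivity), ENNReal.ofReal_one]
    rw [this, one_mul]
  · rw [map_dilate]
    exact hF.mono_ac Measure.smul_absolutelyContinuous

theorem rescale_congr_ae {F G : Plane → C4} (h : F =ᵐ[volume] G) :
    rescale F =ᵐ[volume] rescale G := by
  filter_upwards [quasiMeasurePreserving_dilate.ae h] with w hw
  simp only [rescale, hw]

theorem aestronglyMeasurable_rescale {F : Plane → C4} (hF : AEStronglyMeasurable F) :
    AEStronglyMeasurable (rescale F) :=
  (hF.comp_quasiMeasurePreserving quasiMeasurePreserving_dilate).const_smul (2 * Real.pi)⁻¹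

/-- The reflection `(u, v) ↦ (u, -v)`. -/
def reflect (w : ℝ × ℝ) : ℝ × ℝ := (w.1, -w.2)

theorem measurePreserving_reflect : MeasurePreserving reflect :=
  (MeasurePreserving.id volume).prod (Measure.measurePreserving_neg volume)

theorem measurableEmbedding_reflect : MeasurableEmbedding reflect :=
  ((Homeomorph.refl ℝ).prodCongr (Homeomorph.neg ℝ)).measurableEmbedding

theorem preimage_reflect_square (W : ℝ) : reflect ⁻¹' square W = square W := by
  ext w
  simp only [reflect, square, mem_preimage, mem_prod, mem_Icc]
  constructor <;> rintro ⟨h1, h2, h3⟩ <;> exact ⟨h1, by linarith, by linarith⟩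

end Scaling

/-! ### The quaternionic transform through the complex one -/

section Signals
open scoped FourierTransform

theorem memLp_complexify {g : ℝ × ℝ → ℍ[ℝ]} (hg : MemLp g 2) :
    MemLp (fun v : Plane => complexify (g v.ofLp)) 2 :=
  (hg.comp_measurePreserving measurePreserving_ofLp).continuousLinearMap_comp
    complexify.toContinuousLinearMap

/-- A quaternionic signal as an element of the complex Hilbert space `L²(ℝ²; ℂ⁴)`. -/
noncomputable def signalL2 {g : ℝ × ℝ → ℍ[ℝ]} (hg : MemLp g 2) : Lp C4 2 (volume : Measure Plane) :=
  (memLp_complexify hg).toLp _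

theorem coeFn_signalL2 {g : ℝ × ℝ → ℍ[ℝ]} (hg : MemLp g 2) :
    signalL2 hg =ᵐ[volume] fun v : Plane => complexify (g v.ofLp) :=
  (memLp_complexify hg).coeFn_toLp

theorem signalL2_eq_iff {g : ℝ × ℝ → ℍ[ℝ]} (hg : MemLp g 2) (F : Lp C4 2 (volume : Measure Plane)) :
    signalL2 hg = F ↔ F =ᵐ[volume] fun v : Plane => complexify (g v.ofLp) := by
  rw [eq_comm, Lp.ext_iff]
  exact ⟨fun h => h.trans (coeFn_signalL2 hg), fun h => h.trans (coeFn_signalL2 hg).symm⟩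

theorem signalL2_indicator {g : ℝ × ℝ → ℍ[ℝ]} (hg : MemLp g 2) (T : ℝ)
    (hg' : MemLp ((square T).indicator g) 2) :
    signalL2 hg' = timeProj C4 T (signalL2 hg) := by
  rw [signalL2_eq_iff]
  filter_upwards [coeFn_indicatorL2 (measurableSet_planeSquare T) (signalL2 hg),
    coeFn_signalL2 hg] with v h1 h2
  rw [timeProj, h1]
  by_cases h : v ∈ planeSquare T
  · rw [indicator_of_mem h, h2, indicator_of_mem (show v.ofLp ∈ square T from h)]
  · rw [indicator_of_notMem h, indicator_of_notMem (show v.ofLp ∉ square T from h), map_zero]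

theorem norm_signalL2_sq {g : ℝ × ℝ → ℍ[ℝ]} (hg : MemLp g 2) :
    ‖signalL2 hg‖ ^ 2 = energy g := by
  rw [← indicatorL2_univ (signalL2 hg), norm_indicatorL2_sq, setIntegral_univ, energy,
    ← measurePreserving_ofLp.integral_comp measurableEmbedding_ofLp]
  refine integral_congr_ae ?_
  filter_upwards [coeFn_signalL2 hg] with v hv
  rw [hv, complexify.norm_map]

theorem integrable_fourier_smul {f : Plane → C4} (hf : Integrable f) (w : Plane) :
    Integrable fun v => Complex.exp (((-2 * Real.pi * inner ℝ v w : ℝ) : ℂ) * Complex.I) • f v := by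
  have hc : Continuous fun v : Plane =>
      Complex.exp (((-2 * Real.pi * inner ℝ v w : ℝ) : ℂ) * Complex.I) := by fun_prop
  refine hf.norm.mono' (hc.aestronglyMeasurable.smul hf.aestronglyMeasurable)
    (Eventually.of_forall fun v => ?_)
  rw [norm_smul, Complex.norm_exp_ofReal_mul_I, one_mul]

theorem fourier_clm_comp {f : Plane → C4} (hf : Integrable f) (L : C4 →L[ℂ] C4) (w : Plane) :
    𝓕 (fun v => L (f v)) w = L (𝓕 f w) := by
  rw [Real.fourier_eq', Real.fourier_eq',
    ← L.integral_comp_comm (integrable_fourier_smul hf w)]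
  simp_rw [map_smul]

theorem tendsto_timeProj (f : Lp C4 2 (volume : Measure Plane)) :
    Tendsto (fun n : ℕ => timeProj C4 n f) atTop (𝓝 f) := by
  refine tendsto_indicatorL2 (fun n => measurableSet_planeSquare n) (fun x => ?_) f
  obtain ⟨N, hN⟩ := exists_nat_ge (max |x.fst| |x.snd|)
  filter_upwards [eventually_ge_atTop N] with n hn
  have h : max |x.fst| |x.snd| ≤ (n : ℝ) := hN.trans (by exact_mod_cast hn)
  exact ⟨abs_le.1 ((le_max_left _ _).trans h), abs_le.1 ((le_max_right _ _).trans h)⟩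

/-- Both sides are continuous in `f` and agree on truncations, where the transform is an integral
and `L` passes through it. -/
theorem fourier_compLp (L : C4 →L[ℂ] C4) (f : Lp C4 2 (volume : Measure Plane)) :
    (𝓕 (L.compLpL 2 volume f) : Lp C4 2 (volume : Measure Plane)) =
      L.compLpL 2 volume (𝓕 f) := by
  have hc : Continuous fun f : Lp C4 2 (volume : Measure Plane) =>
      (𝓕 f : Lp C4 2 (volume : Measure Plane)) := (Lp.fourierTransformₗᵢ Plane C4).continuous
  have h1 := ((hc.comp (L.compLpL 2 volume).continuous).tendsto f).comp (tendsto_timeProj f)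
  have h2 := (((L.compLpL 2 volume).continuous.comp hc).tendsto f).comp (tendsto_timeProj f)
  refine tendsto_nhds_unique h1 (h2.congr fun n => ?_)
  simp only [Function.comp_apply]
  have hint := integrable_indicator_planeSquare n f
  have hL : L.compLpL 2 volume (timeProj C4 n f) =ᵐ[volume]
      fun v => L ((planeSquare n).indicator f v) := by
    filter_upwards [L.coeFn_compLpL (timeProj C4 n f),
      coeFn_indicatorL2 (measurableSet_planeSquare (n : ℝ)) f] with v h1 h2
    rw [h1, ← h2]; rfl
  have hm := (memLp_congr_ae hL).1 (Lp.memLp _)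
  have he : L.compLpL 2 volume (timeProj C4 n f) = hm.toLp _ := by
    rw [← Lp.toLp_coeFn (L.compLpL 2 volume (timeProj C4 n f)) (Lp.memLp _)]
    exact (MemLp.toLp_eq_toLp_iff _ _).2 hL
  rw [he]
  refine Lp.ext ?_
  filter_upwards [L.coeFn_compLpL (𝓕 (timeProj C4 n f)), fourier_timeProj_ae_eq n f,
    fourier_toLp_two_ae_eq (L.integrable_comp hint) hm] with v h1 h2 h3
  rw [h1, h2, h3, fourier_clm_comp hint]

/-- The quaternionic Fourier transform, computed from a complex Fourier transform `F`. -/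
noncomputable def assembleQFT (F : Plane → C4) (w : ℝ × ℝ) : ℍ[ℝ] :=
  assemble 1 (rescale F w) + assemble (-1) (rescale F (reflect w))

theorem aestronglyMeasurable_assembleQFT {F : Plane → C4} (hF : AEStronglyMeasurable F) :
    AEStronglyMeasurable (assembleQFT F) := by
  have h := aestronglyMeasurable_rescale hF
  exact ((assemble 1).continuous.comp_aestronglyMeasurable h).add
    ((assemble (-1)).continuous.comp_aestronglyMeasurable
      (h.comp_measurePreserving measurePreserving_reflect))

theorem assembleQFT_congr_ae {F G : Plane → C4} (h : F =ᵐ[volume] G) :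
    assembleQFT F =ᵐ[volume] assembleQFT G := by
  have h1 := rescale_congr_ae h
  filter_upwards [h1, measurePreserving_reflect.quasiMeasurePreserving.ae h1] with w h2 h3
  simp only [assembleQFT, h2, h3]

theorem assembleQFT_sub (F G : Plane → C4) :
    (fun w => assembleQFT F w - assembleQFT G w) = assembleQFT (F - G) := by
  ext1 w
  simp only [assembleQFT, rescale, Pi.sub_apply, smul_sub, map_sub]
  abel

theorem eLpNorm_assembleQFT_le :
    ∃ C : NNReal, ∀ F : Plane → C4, AEStronglyMeasurable F →
      eLpNorm (assembleQFT F) 2 volume ≤ C * eLpNorm F 2 volume := by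
  refine ⟨‖assemble 1‖₊ + ‖assemble (-1)‖₊, fun F hF => ?_⟩
  have h := aestronglyMeasurable_rescale hF
  have key : ∀ (s : ℝ) (G : ℝ × ℝ → C4),
      eLpNorm (fun w => assemble s (G w)) 2 volume ≤ ‖assemble s‖₊ * eLpNorm G 2 volume :=
    fun s G => eLpNorm_le_nnreal_smul_eLpNorm_of_ae_le_mul
      (Eventually.of_forall fun w => (assemble s).le_opNNNorm _) 2
  have h2 : eLpNorm (rescale F ∘ reflect) 2 volume = eLpNorm F 2 volume := by
    rw [← eLpNorm_rescale hF]
    exact eLpNorm_comp_measurePreserving h measurePreserving_reflect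
  refine (eLpNorm_add_le ((assemble 1).continuous.comp_aestronglyMeasurable h)
    ((assemble (-1)).continuous.comp_aestronglyMeasurable
      (h.comp_measurePreserving measurePreserving_reflect)) one_le_two).trans ?_
  refine (add_le_add (key 1 _) (key (-1) _)).trans ?_
  rw [eLpNorm_rescale hF, h2, ENNReal.coe_add, add_mul]

theorem memLp_assembleQFT (F : Lp C4 2 (volume : Measure Plane)) : MemLp (assembleQFT F) 2 := by
  obtain ⟨C, hC⟩ := eLpNorm_assembleQFT_le
  refine ⟨aestronglyMeasurable_assembleQFT (Lp.aestronglyMeasurable F),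
    (hC _ (Lp.aestronglyMeasurable F)).trans_lt ?_⟩
  exact ENNReal.mul_lt_top ENNReal.coe_lt_top (Lp.memLp F).2

theorem qftL1_eq_assembleQFT {f : ℝ × ℝ → ℍ[ℝ]} (hf : Integrable f) (w : ℝ × ℝ) :
    qftL1 f w = assembleQFT (𝓕 fun v : Plane => complexify (f v.ofLp)) w := by
  have hf' : Integrable fun v : Plane => complexify (f v.ofLp) :=
    complexify.toContinuousLinearMap.integrable_comp
      (measurePreserving_ofLp.integrable_comp_of_integrable hf)
  have hpi : Real.pi ≠ 0 := Real.pi_ne_zero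
  rw [qftL1, assembleQFT, rescale, rescale, map_smul, map_smul, ← smul_add, Real.fourier_eq',
    Real.fourier_eq']
  congr 1
  rw [← (assemble 1).integral_comp_comm (integrable_fourier_smul hf' _),
    ← (assemble (-1)).integral_comp_comm (integrable_fourier_smul hf' _),
    ← integral_add ((assemble 1).integrable_comp (integrable_fourier_smul hf' _))
      ((assemble (-1)).integrable_comp (integrable_fourier_smul hf' _)),
    ← measurePreserving_ofLp.integral_comp measurableEmbedding_ofLp]
  refine integral_congr_ae (Eventually.of_forall fun v => ?_)
  simp only [expI_mul_mul_expJ]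
  congr 6
  · simp [dilate, WithLp.prod_inner_apply]
    field_simp
    ring
  · simp [dilate, reflect, WithLp.prod_inner_apply]
    field_simp
    ring

theorem qftL1_truncation_ae_eq {f : ℝ × ℝ → ℍ[ℝ]} (hf : MemLp f 2) (n : ℕ) :
    qftL1 ((square (n : ℝ)).indicator f) =ᵐ[volume]
      assembleQFT (𝓕 (timeProj C4 n (signalL2 hf)) : Lp C4 2 (volume : Measure Plane)) := by
  have hm := hf.indicator (measurableSet_square (n : ℝ))
  have hint : Integrable ((square (n : ℝ)).indicator f) := by
    rw [integrable_indicator_iff (measurableSet_square _)]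
    have : IsFiniteMeasure (volume.restrict (square (n : ℝ))) :=
      ⟨by simpa using (isCompact_square _).measure_lt_top⟩
    exact (hf.restrict _).integrable one_le_two
  have hint' : Integrable fun v : Plane => complexify ((square (n : ℝ)).indicator f v.ofLp) :=
    complexify.toContinuousLinearMap.integrable_comp
      (measurePreserving_ofLp.integrable_comp_of_integrable hint)
  have h1 : qftL1 ((square (n : ℝ)).indicator f) =
      assembleQFT (𝓕 fun v : Plane => complexify ((square (n : ℝ)).indicator f v.ofLp)) :=
    funext fun w => qftL1_eq_assembleQFT hint w
  rw [h1, ← signalL2_indicator hf n hm]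
  exact assembleQFT_congr_ae (fourier_toLp_two_ae_eq hint' (memLp_complexify hm)).symm

/-- Truncations converge in L², the complex transform is an isometry and `assembleQFT` is bounded on
L², so the required limit exists. -/
theorem isQFT_assembleQFT {f : ℝ × ℝ → ℍ[ℝ]} (hf : MemLp f 2) :
    IsQFT f (assembleQFT (𝓕 (signalL2 hf) : Lp C4 2 (volume : Measure Plane))) := by
  refine ⟨memLp_assembleQFT _, ?_⟩
  obtain ⟨C, hC⟩ := eLpNorm_assembleQFT_le
  have hc := (Lp.fourierTransformₗᵢ Plane C4).continuous
  have hlim := (hc.tendsto (signalL2 hf)).comp (tendsto_timeProj (signalL2 hf))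
  rw [Lp.tendsto_Lp_iff_tendsto_eLpNorm'] at hlim
  have hlim' := ENNReal.Tendsto.const_mul (a := (C : ENNReal)) hlim (Or.inr ENNReal.coe_ne_top)
  rw [mul_zero] at hlim'
  refine tendsto_of_tendsto_of_tendsto_of_le_of_le tendsto_const_nhds hlim' (fun _ => bot_le)
    fun n => ?_
  have hae : (fun w => qftL1 ((square (n : ℝ)).indicator f) w -
      assembleQFT (𝓕 (signalL2 hf) : Lp C4 2 (volume : Measure Plane)) w) =ᵐ[volume]
      assembleQFT ((𝓕 (timeProj C4 n (signalL2 hf)) : Lp C4 2 (volume : Measure Plane)) -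
        (𝓕 (signalL2 hf) : Lp C4 2 (volume : Measure Plane)) : Plane → C4) := by
    rw [← assembleQFT_sub]
    filter_upwards [qftL1_truncation_ae_eq hf n] with w hw
    rw [hw]
  rw [eLpNorm_congr_ae hae]
  exact hC _ ((Lp.aestronglyMeasurable _).sub (Lp.aestronglyMeasurable _))

theorem isQFT_qft {f : ℝ × ℝ → ℍ[ℝ]} (hf : MemLp f 2) : IsQFT f (qft f) := by
  have h : ∃ F, IsQFT f F := ⟨_, isQFT_assembleQFT hf⟩
  rw [qft, dif_pos h]
  exact h.choose_spec

/-- `qft` is an arbitrary choice of limit; uniqueness of L² limits makes it computable almost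
everywhere. -/
theorem qft_ae_eq {f : ℝ × ℝ → ℍ[ℝ]} (hf : MemLp f 2) :
    qft f =ᵐ[volume] assembleQFT (𝓕 (signalL2 hf) : Lp C4 2 (volume : Measure Plane)) := by
  obtain ⟨h1, h2⟩ := isQFT_qft hf
  obtain ⟨h3, h4⟩ := isQFT_assembleQFT hf
  set G := assembleQFT (𝓕 (signalL2 hf) : Lp C4 2 (volume : Measure Plane))
  have hmeas : ∀ n : ℕ, AEStronglyMeasurable (qftL1 ((square (n : ℝ)).indicator f)) := fun n =>
    (aestronglyMeasurable_assembleQFT (Lp.aestronglyMeasurable _)).congr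
      (qftL1_truncation_ae_eq hf n).symm
  have hle : ∀ n : ℕ, eLpNorm (qft f - G) 2 volume ≤
      eLpNorm (fun w => qftL1 ((square (n : ℝ)).indicator f) w - G w) 2 volume +
      eLpNorm (fun w => qftL1 ((square (n : ℝ)).indicator f) w - qft f w) 2 volume := by
    intro n
    have : qft f - G = (fun w => qftL1 ((square (n : ℝ)).indicator f) w - G w) -
        fun w => qftL1 ((square (n : ℝ)).indicator f) w - qft f w := by
      ext1 w; simp
    rw [this]
    exact eLpNorm_sub_le ((hmeas n).sub h3.1) ((hmeas n).sub h1.1) one_le_two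
  have h0 : eLpNorm (qft f - G) 2 volume = 0 := by
    refine le_antisymm (ge_of_tendsto (x := atTop) ?_ (Eventually.of_forall hle)) bot_le
    simpa using h4.add h2
  rw [eLpNorm_eq_zero_iff (h1.1.sub h3.1) two_ne_zero] at h0
  filter_upwards [h0] with w hw
  exact sub_eq_zero.1 hw

end Signals

/-! ### Energy ratios as norms of projections -/

section Ratios
open scoped FourierTransform

theorem IsOrthProj.norm_apply_le {H : Type*} [NormedAddCommGroup H] [InnerProductSpace ℂ H]
    {P : H →L[ℂ] H} (hP : IsOrthProj P) (x : H) : ‖P x‖ ≤ ‖x‖ := by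
  have h := norm_inner_le_norm (𝕜 := ℂ) (P x) x
  rw [hP.inner_apply_left, Complex.norm_real, norm_pow, norm_norm, pow_two] at h
  rcases eq_or_ne ‖P x‖ 0 with h0 | h0
  · rw [h0]; exact norm_nonneg x
  · exact le_of_mul_le_mul_left h (lt_of_le_of_ne (norm_nonneg _) h0.symm)

theorem rescale_clm_comp (L : C4 →L[ℂ] C4) (F : Plane → C4) (w : ℝ × ℝ) :
    rescale (fun v => L (F v)) w = L (rescale F w) :=
  (L.map_smul_of_tower (2 * Real.pi)⁻¹ _).symm

theorem norm_qft_component_sq {g : ℝ × ℝ → ℍ[ℝ]} (hg : MemLp g 2) {c : ℍ[ℝ] → ℝ} (hc : Continuous c)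
    (m : Fin 4) (hcm : ∀ q, complexify (c q : ℍ[ℝ]) = coordToFirst m (complexify q)) :
    ∀ᵐ w, ‖qft (fun z => (c (g z) : ℍ[ℝ])) w‖ ^ 2 =
      (‖rescale (𝓕 (signalL2 hg) : Lp C4 2 (volume : Measure Plane)) w m‖ ^ 2 +
       ‖rescale (𝓕 (signalL2 hg) : Lp C4 2 (volume : Measure Plane)) (reflect w) m‖ ^ 2) / 2 := by
  have hle : ∀ q, ‖(c q : ℍ[ℝ])‖ ≤ ‖q‖ := by
    intro q
    rw [← complexify.norm_map, hcm, coordToFirst_apply, PiLp.norm_single,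
      ← complexify.norm_map q]
    exact PiLp.norm_apply_le _ _
  have hgc : MemLp (fun z => (c (g z) : ℍ[ℝ])) 2 :=
    hg.of_le ((Quaternion.continuous_coe.comp hc).comp_aestronglyMeasurable hg.1)
      (Eventually.of_forall fun z => hle _)
  have hs : signalL2 hgc = (coordToFirst m).compLpL 2 volume (signalL2 hg) := by
    rw [signalL2_eq_iff]
    filter_upwards [(coordToFirst m).coeFn_compLpL (signalL2 hg), coeFn_signalL2 hg] with v h1 h2
    rw [h1, h2, hcm]
  have hF : (𝓕 (signalL2 hgc) : Lp C4 2 (volume : Measure Plane)) =ᵐ[volume]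
      fun v => coordToFirst m ((𝓕 (signalL2 hg) : Lp C4 2 (volume : Measure Plane)) v) := by
    rw [hs, fourier_compLp]
    exact (coordToFirst m).coeFn_compLpL _
  filter_upwards [qft_ae_eq hgc, assembleQFT_congr_ae hF] with w h1 h2
  rw [h1, h2, assembleQFT, rescale_clm_comp, rescale_clm_comp, norm_sq_assemble_add]

theorem qModSq_ae_eq {g : ℝ × ℝ → ℍ[ℝ]} (hg : MemLp g 2) :
    ∀ᵐ w, qModSq g w =
      (‖rescale (𝓕 (signalL2 hg) : Lp C4 2 (volume : Measure Plane)) w‖ ^ 2 +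
       ‖rescale (𝓕 (signalL2 hg) : Lp C4 2 (volume : Measure Plane)) (reflect w)‖ ^ 2) / 2 := by
  filter_upwards [
    norm_qft_component_sq hg Quaternion.continuous_re 0 (fun q => by
      ext i; fin_cases i <;> simp [complexify_apply, coordToFirst_apply]),
    norm_qft_component_sq hg Quaternion.continuous_imI 1 (fun q => by
      ext i; fin_cases i <;> simp [complexify_apply, coordToFirst_apply]),
    norm_qft_component_sq hg Quaternion.continuous_imJ 2 (fun q => by
      ext i; fin_cases i <;> simp [complexify_apply, coordToFirst_apply]),
    norm_qft_component_sq hg Quaternion.continuous_imK 3 (fun q => by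
      ext i; fin_cases i <;> simp [complexify_apply, coordToFirst_apply])] with w h0 h1 h2 h3
  rw [qModSq, h0, h1, h2, h3, EuclideanSpace.norm_sq_eq, EuclideanSpace.norm_sq_eq,
    Fin.sum_univ_four, Fin.sum_univ_four]
  ring

/-- On a reflection-invariant region the two terms of the mean have equal integrals, so the
Q-modulus and the complex transform carry the same energy. -/
theorem setIntegral_qModSq {g : ℝ × ℝ → ℍ[ℝ]} (hg : MemLp g 2) {S : Set Plane}
    (hS : reflect ⁻¹' (dilate ⁻¹' S) = dilate ⁻¹' S) :
    ∫ w in dilate ⁻¹' S, qModSq g w =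
      ∫ v in S, ‖(𝓕 (signalL2 hg) : Lp C4 2 (volume : Measure Plane)) v‖ ^ 2 := by
  set F : Lp C4 2 (volume : Measure Plane) := 𝓕 (signalL2 hg) with hF
  have hm : MemLp (rescale F) 2 :=
    ⟨aestronglyMeasurable_rescale (Lp.aestronglyMeasurable F), by
      rw [eLpNorm_rescale (Lp.aestronglyMeasurable F)]; exact (Lp.memLp F).2⟩
  have hi : Integrable fun w => ‖rescale F w‖ ^ 2 := hm.integrable_norm_pow two_ne_zero
  have hi' : Integrable fun w => ‖rescale F (reflect w)‖ ^ 2 :=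
    measurePreserving_reflect.integrable_comp_of_integrable hi
  have hr : ∫ w in dilate ⁻¹' S, ‖rescale F (reflect w)‖ ^ 2 =
      ∫ w in dilate ⁻¹' S, ‖rescale F w‖ ^ 2 := by
    have := measurePreserving_reflect.setIntegral_preimage_emb measurableEmbedding_reflect
      (fun w => ‖rescale F w‖ ^ 2) (dilate ⁻¹' S)
    rwa [hS] at this
  rw [integral_congr_ae (ae_restrict_of_ae (qModSq_ae_eq hg)), integral_div,
    integral_add hi.integrableOn hi'.integrableOn, hr, setIntegral_norm_rescale_sq]
  ring

theorem freqRatio_eq (W : ℝ) {g : ℝ × ℝ → ℍ[ℝ]} (hg : MemLp g 2) (h1 : ‖signalL2 hg‖ = 1) :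
    freqRatio W g = ‖bandProj C4 W (signalL2 hg)‖ := by
  have hW := setIntegral_qModSq hg (S := planeSquare (W / (2 * Real.pi)))
    (by rw [preimage_dilate_planeSquare, preimage_reflect_square])
  -- The whole plane gives the denominator, which Plancherel evaluates to 1.
  have hu := setIntegral_qModSq hg (S := univ) rfl
  rw [preimage_dilate_planeSquare, ← norm_bandProj_sq] at hW
  rw [preimage_univ, setIntegral_univ, ← norm_indicatorL2_sq MeasurableSet.univ,
    indicatorL2_univ, Lp.norm_fourier_eq, h1] at hu
  rw [freqRatio, hW, hu, one_pow, div_one, Real.sqrt_sq (norm_nonneg _)]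

theorem timeRatio_eq (T : ℝ) {g : ℝ × ℝ → ℍ[ℝ]} (hg : MemLp g 2) (h1 : ‖signalL2 hg‖ = 1) :
    timeRatio T g = ‖timeProj C4 T (signalL2 hg)‖ := by
  have hg' := hg.indicator (measurableSet_square T)
  rw [timeRatio, ← norm_signalL2_sq hg, h1, timeLimit, ← norm_signalL2_sq hg',
    signalL2_indicator hg T hg', one_pow, div_one, Real.sqrt_sq (norm_nonneg _)]

theorem norm_signalL2_eq_one {g : ℝ × ℝ → ℍ[ℝ]} (hg : MemLp g 2) (h : energy g = 1) :
    ‖signalL2 hg‖ = 1 := by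
  rw [← norm_signalL2_sq hg] at h
  exact (pow_eq_one_iff_of_nonneg (norm_nonneg _) two_ne_zero).1 h

end Ratios

/-! ### Eigenfunctions of the integral equation and of QP -/

section Eigenfunctions

theorem measurable_sincKernel (W : ℝ) : Measurable (sincKernel W) :=
  Measurable.ite (measurableSet_singleton 0) measurable_const (by fun_prop)

theorem abs_sincKernel_le {W : ℝ} (hW : 0 < W) (r : ℝ) : |sincKernel W r| ≤ W / Real.pi := by
  rw [sincKernel]
  split_ifs with h
  · rw [abs_of_pos (by positivity)]
  · rw [abs_div, abs_mul, abs_of_pos Real.pi_pos]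
    have h1 := Real.abs_sin_le_abs (x := W * r)
    rw [abs_mul, abs_of_pos hW] at h1
    have h2 : 0 < |r| := abs_pos.2 h
    rw [div_le_div_iff₀ (by positivity) Real.pi_pos]
    nlinarith [Real.pi_pos]

theorem integrableOn_sincKernel_smul (T : ℝ) {W : ℝ} (hW : 0 < W) (x : Plane)
    (Φ : Lp C4 2 (volume : Measure Plane)) :
    IntegrableOn (fun s : Plane =>
      (sincKernel W (x.fst - s.fst) * sincKernel W (x.snd - s.snd)) • Φ s) (planeSquare T) := by
  have hΦ : IntegrableOn Φ (planeSquare T) := by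
    rw [← integrable_indicator_iff (measurableSet_planeSquare T)]
    exact integrable_indicator_planeSquare T Φ
  have hm : Measurable fun s : Plane =>
      sincKernel W (x.fst - s.fst) * sincKernel W (x.snd - s.snd) :=
    ((measurable_sincKernel W).comp (by fun_prop)).mul ((measurable_sincKernel W).comp (by fun_prop))
  refine hΦ.bdd_smul (W / Real.pi * (W / Real.pi)) hm.aestronglyMeasurable
    (Eventually.of_forall fun s => ?_)
  rw [Real.norm_eq_abs, abs_mul]
  exact mul_le_mul (abs_sincKernel_le hW _) (abs_sincKernel_le hW _) (abs_nonneg _) (by positivity)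

theorem setIntegral_square_eq_planeSquare (T : ℝ) (f : ℝ × ℝ → ℍ[ℝ]) :
    ∫ s in square T, f s = ∫ v in planeSquare T, f v.ofLp :=
  (measurePreserving_ofLp.setIntegral_preimage_emb measurableEmbedding_ofLp f (square T)).symm

theorem signalL2_eigen (T : ℝ) {W lam : ℝ} (hW : 0 < W) {ψ : ℝ × ℝ → ℍ[ℝ]}
    (h : IsSincEigenfunction T W lam ψ) :
    bandProj C4 W (timeProj C4 T (signalL2 h.1)) = (lam : ℂ) • signalL2 h.1 := by
  refine Lp.ext ?_
  filter_upwards [bandProj_timeProj_ae_eq T hW (signalL2 h.1), coeFn_signalL2 h.1,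
    Lp.coeFn_smul (lam : ℂ) (signalL2 h.1),
    measurePreserving_ofLp.quasiMeasurePreserving.ae h.2.2] with v h1 h2 h3 h4
  have h5 : complexify (lam • ψ v.ofLp) = ∫ s in planeSquare T,
      complexify ((sincKernel W (v.fst - s.fst) * sincKernel W (v.snd - s.snd)) • ψ s.ofLp) := by
    rw [h4, setIntegral_square_eq_planeSquare, ← complexify.integral_comp_comm]
    rfl
  rw [h1, h3, Pi.smul_apply, h2, Complex.coe_smul, ← map_smul, h5]
  refine integral_congr_ae (ae_restrict_of_ae ?_)
  filter_upwards [coeFn_signalL2 h.1] with s hs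
  rw [hs, map_smul]

theorem signalL2_ne_zero {ψ : ℝ × ℝ → ℍ[ℝ]} (hψ : MemLp ψ 2) (h0 : ¬ ψ =ᵐ[volume] 0) :
    signalL2 hψ ≠ 0 := by
  intro h
  refine h0 ?_
  rw [signalL2_eq_iff] at h
  have h1 : ∀ᵐ v : Plane, ψ v.ofLp = 0 := by
    filter_upwards [h, Lp.coeFn_zero C4 2 (volume : Measure Plane)] with v h2 h3
    rw [h3, Pi.zero_apply] at h2
    exact complexify.injective (h2.symm.trans (map_zero _).symm)
  filter_upwards [measurePreserving_toLp.quasiMeasurePreserving.ae h1] with z hz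
  exact hz

/-- Kernel and eigenvalue are real, so the real and imaginary parts of a ℂ⁴-valued eigenvector solve
the equation separately, and at least one of them is not null. -/
theorem exists_sincEigenfunction (T : ℝ) {W lam : ℝ} (hW : 0 < W)
    {Φ : Lp C4 2 (volume : Measure Plane)} (h0 : Φ ≠ 0)
    (h : bandProj C4 W (timeProj C4 T Φ) = (lam : ℂ) • Φ) :
    lam ∈ sincEigenvalues T W := by
  have key : ∀ L : C4 →L[ℝ] ℍ[ℝ], MemLp (fun z => L (Φ (WithLp.toLp 2 z))) 2 ∧
      ∀ᵐ z : ℝ × ℝ, lam • L (Φ (WithLp.toLp 2 z)) = ∫ s in square T,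
        (sincKernel W (z.1 - s.1) * sincKernel W (z.2 - s.2)) • L (Φ (WithLp.toLp 2 s)) := by
    intro L
    refine ⟨((Lp.memLp Φ).comp_measurePreserving
      measurePreserving_toLp).continuousLinearMap_comp L, ?_⟩
    have h1 : ∀ᵐ v : Plane, lam • Φ v = ∫ s in planeSquare T,
        (sincKernel W (v.fst - s.fst) * sincKernel W (v.snd - s.snd)) • Φ s := by
      filter_upwards [bandProj_timeProj_ae_eq T hW Φ, Lp.coeFn_smul (lam : ℂ) Φ] with v h2 h3
      rw [← h2, h, h3, Pi.smul_apply, Complex.coe_smul]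
    filter_upwards [measurePreserving_toLp.quasiMeasurePreserving.ae h1] with z hz
    rw [← map_smul, hz, ← L.integral_comp_comm (integrableOn_sincKernel_smul T hW _ Φ),
      setIntegral_square_eq_planeSquare]
    simp_rw [map_smul]
    rfl
  by_cases hr : (fun z => realPart (Φ (WithLp.toLp 2 z))) =ᵐ[volume] 0
  · refine ⟨fun z => imagPart (Φ (WithLp.toLp 2 z)), (key imagPart).1, fun hi => h0 ?_,
      (key imagPart).2⟩
    refine Lp.ext ?_
    filter_upwards [measurePreserving_ofLp.quasiMeasurePreserving.ae hr,
      measurePreserving_ofLp.quasiMeasurePreserving.ae hi,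
      Lp.coeFn_zero C4 2 (volume : Measure Plane)] with v h1 h2 h3
    rw [h3]
    exact eq_zero_of_realPart_imagPart h1 h2
  · exact ⟨fun z => realPart (Φ (WithLp.toLp 2 z)), (key realPart).1, hr, (key realPart).2⟩

theorem IsSincEigenfunction.const_smul {T W lam : ℝ} {ψ : ℝ × ℝ → ℍ[ℝ]}
    (h : IsSincEigenfunction T W lam ψ) {c : ℝ} (hc : c ≠ 0) :
    IsSincEigenfunction T W lam (c • ψ) := by
  refine ⟨h.1.const_smul c, fun h0 => h.2.1 ?_, ?_⟩
  · filter_upwards [h0] with z hz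
    exact (smul_eq_zero.1 hz).resolve_left hc
  · filter_upwards [h.2.2] with z hz
    simp_rw [Pi.smul_apply, smul_comm _ c]
    rw [integral_smul, hz]

theorem energy_const_smul (c : ℝ) (g : ℝ × ℝ → ℍ[ℝ]) : energy (c • g) = c ^ 2 * energy g := by
  simp only [energy, Pi.smul_apply, norm_smul, mul_pow, integral_const_mul, Real.norm_eq_abs,
    sq_abs]

theorem exists_unit_sincEigenfunction {T W lam : ℝ} (h : lam ∈ sincEigenvalues T W) :
    ∃ ψ, IsSincEigenfunction T W lam ψ ∧ energy ψ = 1 := by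
  obtain ⟨ψ, hψ⟩ := h
  have hpos : 0 < energy ψ := by
    rw [← norm_signalL2_sq hψ.1]
    have := norm_pos_iff.2 (signalL2_ne_zero hψ.1 hψ.2.1)
    positivity
  refine ⟨(√(energy ψ))⁻¹ • ψ, hψ.const_smul (by positivity), ?_⟩
  rw [energy_const_smul, inv_pow, Real.sq_sqrt hpos.le, inv_mul_cancel₀ hpos.ne']

theorem isGreatest_sincEigenvalues {T W : ℝ} (hT : 0 < T) (hW : 0 < W) :
    IsGreatest (sincEigenvalues T W) (‖bandProj C4 W ∘L timeProj C4 T‖ ^ 2) := by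
  have hP := isOrthProj_timeProj (E := C4) T
  have hQ := isOrthProj_bandProj (E := C4) W
  constructor
  · obtain ⟨f, hf, hmax⟩ := exists_norm_bandProj_timeProj_eq (E := C4) T W
    obtain ⟨Φ, h0, h⟩ := exists_eigenvector_of_norm_attained hP hQ
      (bandProj_comp_timeProj_ne_zero hT hW) hf hmax
    exact exists_sincEigenfunction T hW h0 h
  · rintro lam ⟨ψ, hψ⟩
    exact eigenvalue_le_norm_sq hP hQ (signalL2_ne_zero hψ.1 hψ.2.1) (signalL2_eigen T hW hψ)

theorem signalL2_add_smul {p q T : ℝ} {ψ : ℝ × ℝ → ℍ[ℝ]} (hψ : MemLp ψ 2)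
    (hg : MemLp (p • ψ + q • timeLimit T ψ) 2) :
    signalL2 hg = (p : ℂ) • signalL2 hψ + (q : ℂ) • timeProj C4 T (signalL2 hψ) := by
  have hψ' := hψ.indicator (measurableSet_square T)
  rw [← signalL2_indicator hψ T hψ', signalL2_eq_iff]
  filter_upwards [coeFn_signalL2 hψ, coeFn_signalL2 hψ',
    Lp.coeFn_add ((p : ℂ) • signalL2 hψ) ((q : ℂ) • signalL2 hψ'),
    Lp.coeFn_smul (p : ℂ) (signalL2 hψ), Lp.coeFn_smul (q : ℂ) (signalL2 hψ')] with v h1 h2 h3 h4 h5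
  rw [h3, Pi.add_apply, h4, h5, Pi.smul_apply, Pi.smul_apply, h1, h2, Complex.coe_smul,
    Complex.coe_smul, Pi.add_apply, Pi.smul_apply, Pi.smul_apply, map_add, map_smul, map_smul]
  rfl

end Eigenfunctions
end QPSWF

/-! ### The extremal problem for signals -/

open QPSWF
theorem mainTheorem1 (T W : ℝ) (hT : 0 < T) (hW : 0 < W) :
    (∀ f : ℝ × ℝ → ℍ[ℝ], MemLp f 2 volume → IsQFT f (qft f)) ∧
    ∃ lam0 : ℝ, IsGreatest (sincEigenvalues T W) lam0 ∧
      ∀ ξ : ℝ, √lam0 ≤ ξ → ξ < 1 →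
        (∀ g ∈ unitSignals T ξ,
          Real.arccos √lam0 ≤ Real.arccos ξ + Real.arccos (freqRatio W g)) ∧
        (∀ ψ₀ : ℝ × ℝ → ℍ[ℝ], IsSincEigenfunction T W lam0 ψ₀ → energy ψ₀ = 1 →
          ∀ p q : ℝ, p = √((1 - ξ ^ 2) / (1 - lam0)) →
            q = ξ / √lam0 - √((1 - ξ ^ 2) / (1 - lam0)) →
            (p • ψ₀ + q • timeLimit T ψ₀) ∈ unitSignals T ξ ∧
            Real.arccos ξ + Real.arccos (freqRatio W (p • ψ₀ + q • timeLimit T ψ₀)) =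
              Real.arccos √lam0) ∧
        (∃ η : ℝ, 0 ≤ η ∧ η ≤ 1 ∧ IsGreatest (freqRatio W '' unitSignals T ξ) η ∧
          Real.arccos ξ + Real.arccos η = Real.arccos √lam0) := by
  refine ⟨fun f hf => isQFT_qft hf, _, isGreatest_sincEigenvalues hT hW, fun ξ hξ hξ1 => ?_⟩
  have hgreat := isGreatest_sincEigenvalues hT hW
  have hP := isOrthProj_timeProj (E := C4) T
  have hQ := isOrthProj_bandProj (E := C4) W
  have hpos : 0 < ‖bandProj C4 W ∘L timeProj C4 T‖ :=
    norm_pos_iff.2 (bandProj_comp_timeProj_ne_zero hT hW)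
  have hsqrt : √(‖bandProj C4 W ∘L timeProj C4 T‖ ^ 2) = ‖bandProj C4 W ∘L timeProj C4 T‖ :=
    Real.sqrt_sq hpos.le
  have ha : ∀ g ∈ unitSignals T ξ, Real.arccos √(‖bandProj C4 W ∘L timeProj C4 T‖ ^ 2) ≤
      Real.arccos ξ + Real.arccos (freqRatio W g) := by
    rintro g ⟨hg, hg1, rfl⟩
    have h1 := norm_signalL2_eq_one hg hg1
    rw [hsqrt, timeRatio_eq T hg h1, freqRatio_eq W hg h1]
    exact arccos_norm_comp_le hP hQ h1
  have hb : ∀ ψ₀ : ℝ × ℝ → ℍ[ℝ],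
      IsSincEigenfunction T W (‖bandProj C4 W ∘L timeProj C4 T‖ ^ 2) ψ₀ → energy ψ₀ = 1 →
      ∀ p q : ℝ, p = √((1 - ξ ^ 2) / (1 - ‖bandProj C4 W ∘L timeProj C4 T‖ ^ 2)) →
        q = ξ / √(‖bandProj C4 W ∘L timeProj C4 T‖ ^ 2) -
          √((1 - ξ ^ 2) / (1 - ‖bandProj C4 W ∘L timeProj C4 T‖ ^ 2)) →
        (p • ψ₀ + q • timeLimit T ψ₀) ∈ unitSignals T ξ ∧
        Real.arccos ξ + Real.arccos (freqRatio W (p • ψ₀ + q • timeLimit T ψ₀)) =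
          Real.arccos √(‖bandProj C4 W ∘L timeProj C4 T‖ ^ 2) := by
    intro ψ₀ hψ hψ1 p q hp hq
    have hg : MemLp (p • ψ₀ + q • timeLimit T ψ₀) 2 :=
      (hψ.1.const_smul p).add ((hψ.1.indicator (measurableSet_square T)).const_smul q)
    obtain ⟨h1, h2, h3⟩ := extremal_of_eigen hP hQ (pow_pos hpos 2)
      (norm_signalL2_eq_one hψ.1 hψ1) (signalL2_eigen T hW hψ) hξ hξ1 hp hq
    rw [← signalL2_add_smul hψ.1 hg] at h1 h2 h3
    refine ⟨⟨hg, ?_, ?_⟩, ?_⟩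
    · rw [← norm_signalL2_sq hg, h1, one_pow]
    · rw [timeRatio_eq T hg h1, h2]
    · rw [freqRatio_eq W hg h1, h3]
  refine ⟨ha, hb, ?_⟩
  -- A normalized top eigenfunction exists, so the extremal signal of (b) supplies the maximizer.
  obtain ⟨ψ, hψ, hψ1⟩ := exists_unit_sincEigenfunction hgreat.1
  obtain ⟨hmem, heq⟩ := hb ψ hψ hψ1 _ _ rfl rfl
  have hbd : ∀ g ∈ unitSignals T ξ, 0 ≤ freqRatio W g ∧ freqRatio W g ≤ 1 := by
    rintro g ⟨hg, hg1, -⟩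
    have h1 := norm_signalL2_eq_one hg hg1
    rw [freqRatio_eq W hg h1]
    exact ⟨norm_nonneg _, (hQ.norm_apply_le _).trans h1.le⟩
  refine ⟨_, (hbd _ hmem).1, (hbd _ hmem).2, ⟨mem_image_of_mem _ hmem, ?_⟩, heq⟩
  rintro _ ⟨g, hg, rfl⟩
  have h1 := ha g hg
  rw [← heq] at h1
  have hneg : ∀ g ∈ unitSignals T ξ, freqRatio W g ∈ Icc (-1 : ℝ) 1 := fun g hg =>
    ⟨by linarith [(hbd g hg).1], (hbd g hg).2⟩
  -- Both ratios lie in [-1, 1], where arccos is strictly decreasing, so the angle bound (a) becomes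
  -- an upper bound for the frequency ratio.
  exact (Real.strictAntiOn_arccos.le_iff_ge (hneg _ hmem) (hneg g hg)).1 (by linarith)
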